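/- Let $\mathbb{T}^n=\mathbb{R}^n/\mathbb{Z}^n$ with normalised Haar measure $dx$, let $(Y,\nu)$ be a $\sigma$-finite measure space such that the complex Hilbert space $H=L^2(Y,\nu)$ is separable, and let $0<s\le 1$, $1\le p<\infty$, $\frac1p+\frac1{p'}=1$. For integrable $f:\mathbb{T}^n\to H$ put $\widehat f(\xi)=\int_{\mathbb{T}^n}e^{-2\pi i x\cdot\xi}f(x)\,dx\in H$, $\xi\in\mathbb{Z}^n$ (Bochner integral). For $h,w,v\in H$ let $(h\otimes w)v=\left(\int_Y w(z)v(z)\,d\nu(z)\right)h$. Let $\sigma:\mathbb{T}^n\times\mathbb{Z}^n\to\mathcal{L}(H)$ be any function into the bounded operators on $H$, and consider the periodic pseudo-differential operator $$T_\sigma f(x)=\sum_{\xi\in\mathbb{Z}^n}e^{2\pi i x\cdot\xi}\,\sigma(x,\xi)\widehat f(\xi),\qquad f\in C^\infty(\mathbb{T}^n,H).$$ A bounded operator $T$ on $L^p(\mathbb{T}^n,H)$ extends $T_\sigma$ if for every $f\in C^\infty(\mathbb{T}^n,H)$ this series converges unconditionally in $H$ to $Tf(x)$ for almost every $x$. A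 bounded operator $T:E\to F$ between Banach spaces is $s$-nuclear if there are sequences $(\varphi_k)_k\subset E'$ and $(u_k)_k\subset F$ with $\sum_k\|\varphi_k\|^s\|u_k\|^s<\infty$ and $Tf=\sum_k\varphi_k(f)u_k$ for all $f\in E$. Theorem. $T_\sigma$ extends to an $s$-nuclear operator on $L^p(\mathbb{T}^n,H)$ if and only if there are sequences $(h_k)_k\subset L^{p}(\mathbb{T}^n,H)$ and $(g_k)_k\subset L^{p'}(\mathbb{T}^n,H)$ with $\sum_{k}\|h_k\|_{L^p}^s\|g_k\|_{L^{p'}}^s<\infty$ such that, for almost every $x\in\mathbb{T}^n$, $$\sigma(x,\xi)v=e^{-2\pi i x\cdot\xi}\sum_{k}\bigl(h_k(x)\otimes\widehat{g_k}(-\xi)\bigr)v\qquad\text{for all }\xi\in\mathbb{Z}^n,\ v\in H,$$ with convergence in the norm of $H$. In particular, if a bounded operator $T$ on $L^p(\mathbb{T}^n,H)$ extends $T_\sigma$, then $T$ is $s$-nuclear if and only if such sequences exist. -/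

import Mathlib

open MeasureTheory
open scoped ENNReal ContDiff

noncomputable section

/-- The normalised Haar measure `dx` on the torus `𝕋ⁿ = (ℝ/ℤ)ⁿ`. -/
abbrev torusMeasure (n : ℕ) : Measure (UnitAddTorus (Fin n)) :=
  Measure.pi fun _ : Fin n => AddCircle.haarAddCircle

/-- Smoothness of a function on the torus: the associated `ℤⁿ`-periodic function on `ℝⁿ`
is of class `C^∞`. -/
def IsTorusSmooth {n : ℕ} {H : Type*} [NormedAddCommGroup H] [NormedSpace ℝ H]
    (f : UnitAddTorus (Fin n) → H) : Prop :=
  ContDiff ℝ ∞ fun y : Fin n → ℝ => f fun i => (y i : UnitAddCircle)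

/-- A bounded operator `T : E → F` between Banach spaces is `s`-nuclear if
`T f = ∑ₖ ⟨gₖ, f⟩ hₖ` for some `gₖ ∈ E'`, `hₖ ∈ F` with `∑ₖ ‖gₖ‖ˢ ‖hₖ‖ˢ < ∞`. -/
def IsSNuclear {E F : Type*} [NormedAddCommGroup E] [NormedSpace ℂ E]
    [NormedAddCommGroup F] [NormedSpace ℂ F] (s : ℝ) (T : E →L[ℂ] F) : Prop :=
  ∃ (g : ℕ → (E →L[ℂ] ℂ)) (h : ℕ → F),
    (Summable fun k => ‖g k‖ ^ s * ‖h k‖ ^ s) ∧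
      ∀ f : E, HasSum (fun k => g k f • h k) (T f)

/-- `T` is a bounded operator on `L^p(𝕋ⁿ, H)` extending the periodic pseudo-differential operator
`T_σ f(x) = ∑_{ξ ∈ ℤⁿ} e^{2πi x·ξ} σ(x, ξ) f̂(ξ)`, `f ∈ C^∞(𝕋ⁿ, H)`, with symbol `σ`. -/
def ExtendsPeriodicOperator {n : ℕ} {H : Type*} [NormedAddCommGroup H] [NormedSpace ℂ H]
    {p : ℝ≥0∞} [Fact (1 ≤ p)] (σ : UnitAddTorus (Fin n) → (Fin n → ℤ) → (H →L[ℂ] H))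
    (T : Lp H p (torusMeasure n) →L[ℂ] Lp H p (torusMeasure n)) : Prop :=
  ∀ f : C(UnitAddTorus (Fin n), H), IsTorusSmooth f →
    ∀ᵐ x ∂(torusMeasure n),
      HasSum (fun ξ : Fin n → ℤ =>
        UnitAddTorus.mFourier ξ x • σ x ξ (UnitAddTorus.mFourierCoeff f ξ))
        (T (ContinuousMap.toLp p (torusMeasure n) ℂ f) x)

/-- For `h, w ∈ L²(Y, ν)`, the tensor `h ⊗ w`, that is `(h ⊗ w)(z, z') = h(z) w(z')`, acts on
`L²(Y, ν)` as an integral kernel: `(h ⊗ w) v = (∫_Y w(z) v(z) dν(z)) h`, a bilinear pairing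
without complex conjugation. -/
def tensorAct {Y : Type*} [MeasurableSpace Y] {ν : Measure Y} (h w v : Lp ℂ 2 ν) : Lp ℂ 2 ν :=
  (∫ z, w z * v z ∂ν) • h

/-- `σ(x, ξ) v = e^{-2πi x·ξ} (∑ₖ hₖ(x) ⊗ ĝₖ(-ξ)) v` for almost every `x`, all `ξ` and all `v`, with
`hₖ ∈ L^p(𝕋ⁿ, L²(Y, ν))`, `gₖ ∈ L^q(𝕋ⁿ, L²(Y, ν))` and `∑ₖ ‖hₖ‖ˢ ‖gₖ‖ˢ < ∞`. -/
def HasNuclearSymbol {n : ℕ} {Y : Type*} [MeasurableSpace Y] {ν : Measure Y} (s : ℝ) (p q : ℝ≥0∞)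
    (σ : UnitAddTorus (Fin n) → (Fin n → ℤ) → (Lp ℂ 2 ν →L[ℂ] Lp ℂ 2 ν)) : Prop :=
  ∃ (h : ℕ → Lp (Lp ℂ 2 ν) p (torusMeasure n)) (g : ℕ → Lp (Lp ℂ 2 ν) q (torusMeasure n)),
    (Summable fun k => ‖h k‖ ^ s * ‖g k‖ ^ s) ∧
      ∀ᵐ x ∂(torusMeasure n), ∀ (ξ : Fin n → ℤ) (v : Lp ℂ 2 ν),
        HasSum (fun k => UnitAddTorus.mFourier (-ξ) x •
          tensorAct (h k x) (UnitAddTorus.mFourierCoeff (g k) (-ξ)) v) (σ x ξ v)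

end

noncomputable section


/-! ### Characters and Fourier coefficients on the torus -/

namespace UnitAddTorus

variable {n : ℕ} {H : Type*} [NormedAddCommGroup H] [NormedSpace ℂ H]

/-! Write B(w, v) = ∫ w v dν. The bridge between the two sides is duality: for p < ∞ every
functional on L^p(𝕋ⁿ, H) is f ↦ ∫ B(g(x), f(x)) dx with g ∈ L^{p'}(𝕋ⁿ, H) of norm at most that of
the functional (`exists_lp_dual_repr`, `exists_eq_lpPairing_bilinPairing`). An s-nuclear operator is
therefore T f = ∑ₖ ⟨gₖ, f⟩ hₖ, and the series converges absolutely because s ≤ 1.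

From operator to symbol, test on the monomial e^{2πi x·ξ} v. The extension property gives e^{2πi
x·ξ} σ(x, ξ) v, while each pairing is B(ĝₖ(-ξ), v); dividing by the character yields the formula for
almost every x. A countable dense set of v makes the null set uniform, and absolute convergence
reaches all v.

From symbol to operator, the series ∑ₖ ⟨gₖ, ·⟩ hₖ defines T. The sums over ξ and k may be exchanged
(`hasSum_mFourier_smul_symbol`), since a smooth f has absolutely summable Fourier coefficients and
∑ₖ ‖gₖ‖ ‖hₖ(x)‖ < ∞ for almost every x. Monomials span a dense subspace, so the extension is unique,
which gives the last claim.

Duality splits at p = 2. For p ≥ 2, ‖f‖^p / p - Re φ(f) has a minimiser by Clarkson's inequality,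
and its first-order condition is the representation. For p ≤ 2, Riesz representation on L² ⊂ L^p
produces g ∈ L², and testing φ on truncated powers of g puts g in L^{p'}. -/

theorem norm_mFourier_apply (ξ : Fin n → ℤ) (x : UnitAddTorus (Fin n)) :
    ‖mFourier ξ x‖ = 1 := by
  simp only [mFourier, ContinuousMap.coe_mk, fourier_apply, norm_prod, Circle.norm_coe,
    Finset.prod_const_one]

theorem mFourier_neg_mul (ξ : Fin n → ℤ) (x : UnitAddTorus (Fin n)) :
    mFourier (-ξ) x * mFourier ξ x = 1 := by
  rw [← mFourier_add, neg_add_cancel, mFourier_zero]; rfl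

theorem mFourier_mul_neg (ξ : Fin n → ℤ) (x : UnitAddTorus (Fin n)) :
    mFourier ξ x * mFourier (-ξ) x = 1 := by
  rw [mul_comm, mFourier_neg_mul]

theorem mFourier_apply_add (ξ : Fin n → ℤ) (x y : UnitAddTorus (Fin n)) :
    mFourier ξ (x + y) = mFourier ξ x * mFourier ξ y := by
  simp only [mFourier, ContinuousMap.coe_mk, Pi.add_apply, ← Finset.prod_mul_distrib]
  refine Finset.prod_congr rfl fun i _ => ?_
  simp only [fourier_apply, smul_add, AddCircle.toCircle_add, Circle.coe_mul]

theorem mFourier_apply_coe (ξ : Fin n → ℤ) (y : Fin n → ℝ) :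
    mFourier ξ (fun i => (y i : UnitAddCircle)) =
      Complex.exp (2 * Real.pi * Complex.I * ∑ i, (ξ i : ℂ) * y i) := by
  simp only [mFourier, ContinuousMap.coe_mk, fourier_coe_apply, Finset.mul_sum, Complex.exp_sum]
  refine Finset.prod_congr rfl fun i _ => ?_
  congr 1
  push_cast
  ring

theorem mFourierCoeff_eq (f : UnitAddTorus (Fin n) → H) (ξ : Fin n → ℤ) :
    mFourierCoeff f ξ = ∫ t, mFourier (-ξ) t • f t ∂(torusMeasure n) := rfl

theorem norm_mFourierCoeff_le (f : UnitAddTorus (Fin n) → H) (ξ : Fin n → ℤ) {C : ℝ}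
    (hC : ∀ x, ‖f x‖ ≤ C) : ‖mFourierCoeff f ξ‖ ≤ C := by
  rw [mFourierCoeff_eq]
  refine (norm_integral_le_of_norm_le_const (C := C) (.of_forall fun x => ?_)).trans ?_
  · rw [norm_smul, norm_mFourier_apply, one_mul]; exact hC x
  · simp

theorem norm_mFourierCoeff_le_norm_Lp {q : ℝ≥0∞} [Fact (1 ≤ q)] (g : Lp H q (torusMeasure n))
    (ξ : Fin n → ℤ) : ‖mFourierCoeff g ξ‖ ≤ ‖g‖ := by
  rw [mFourierCoeff_eq]
  refine (norm_integral_le_integral_norm _).trans ?_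
  simp only [norm_smul, norm_mFourier_apply, one_mul]
  have h1 : eLpNorm g 1 (torusMeasure n) ≤ eLpNorm g q (torusMeasure n) :=
    eLpNorm_le_eLpNorm_of_exponent_le Fact.out (Lp.aestronglyMeasurable g)
  rw [Lp.norm_def, integral_norm_eq_lintegral_enorm (Lp.aestronglyMeasurable g),
    ← eLpNorm_one_eq_lintegral_enorm]
  exact ENNReal.toReal_mono (Lp.eLpNorm_ne_top g) h1

/-- Differentiating this identity in `a` replaces integration by parts in
`IsTorusSmooth.mFourierCoeff_coordDeriv`. -/
theorem mFourierCoeff_translate (f : UnitAddTorus (Fin n) → H) (ξ : Fin n → ℤ)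
    (a : UnitAddTorus (Fin n)) :
    mFourierCoeff (fun x => f (x + a)) ξ = mFourier ξ a • mFourierCoeff f ξ := by
  simp only [mFourierCoeff_eq]
  rw [← integral_add_right_eq_self (fun t => mFourier (-ξ) t • f t) a, ← integral_smul]
  refine integral_congr_ae (.of_forall fun x => ?_)
  simp only [mFourier_apply_add, smul_smul]
  rw [mul_comm (mFourier (-ξ) x), ← mul_assoc, mFourier_mul_neg, one_mul]

/-- The monomial `x ↦ e^{2πi x·ξ} v`. -/
def mFourierSMul (ξ : Fin n → ℤ) (v : H) : C(UnitAddTorus (Fin n), H) :=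
  ⟨fun x => mFourier ξ x • v, by fun_prop⟩

@[simp]
theorem mFourierSMul_apply (ξ : Fin n → ℤ) (v : H) (x : UnitAddTorus (Fin n)) :
    mFourierSMul ξ v x = mFourier ξ x • v := rfl

theorem mFourierCoeff_mFourierSMul [CompleteSpace H] (ξ η : Fin n → ℤ) (v : H) :
    mFourierCoeff (mFourierSMul ξ v) η = if η = ξ then v else 0 := by
  have h := orthonormal_iff_ite.mp (orthonormal_mFourier (d := Fin n)) η ξ
  simp only [ContinuousMap.inner_toLp, ← mFourier_neg] at h
  rw [mFourierCoeff_eq]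
  simp only [mFourierSMul_apply, smul_smul]
  rw [integral_smul_const]
  have h' : ∫ x, mFourier (-η) x * mFourier ξ x ∂(torusMeasure n) = if η = ξ then 1 else 0 := by
    rw [← h]
    refine integral_congr_ae (.of_forall fun x => mul_comm _ _)
  rw [h']
  split_ifs <;> simp

/-- The derivative of a function on the torus in the `j`-th coordinate direction. -/
def coordDeriv (j : Fin n) (f : UnitAddTorus (Fin n) → H) (x : UnitAddTorus (Fin n)) : H :=
  deriv (fun t : ℝ => f (x + Pi.single j (t : UnitAddCircle))) 0

theorem isOpenQuotientMap_coe :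
    IsOpenQuotientMap fun (y : Fin n → ℝ) (i : Fin n) => (y i : UnitAddCircle) :=
  IsOpenQuotientMap.piMap fun _ => QuotientAddGroup.isOpenQuotientMap_mk

theorem coe_add_single (y : Fin n → ℝ) (j : Fin n) (t : ℝ) :
    (fun i => (y i : UnitAddCircle)) + Pi.single j (t : UnitAddCircle) =
      fun i => ((y + t • (Pi.single j 1 : Fin n → ℝ)) i : UnitAddCircle) := by
  ext i
  by_cases h : i = j
  · subst h; simp
  · simp [h]

end UnitAddTorus

/-! ### Smooth functions: decay of coefficients and Fourier inversion -/

open UnitAddTorus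

variable {n : ℕ} {H : Type*} [NormedAddCommGroup H] [NormedSpace ℂ H]

theorem exists_norm_apply_eq {ι : Type*} [Fintype ι] [Nonempty ι] (x : ι → ℝ) :
    ∃ j, |x j| = ‖x‖ := by
  obtain ⟨j, hj⟩ := Finite.exists_max fun i => ‖x i‖
  exact ⟨j, le_antisymm (norm_le_pi_norm x j) ((pi_norm_le_iff_of_nonneg (norm_nonneg _)).mpr hj)⟩

theorem exists_summable_norm_pow_inv (n : ℕ) :
    ∃ m : ℕ, Summable fun ξ : Fin n → ℤ => (‖fun i => (ξ i : ℝ)‖ ^ (m + 1))⁻¹ := by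
  set L := Submodule.span ℤ (Set.range (Pi.basisFun ℝ (Fin n))) with hL
  -- Lattice sums of ‖ξ‖^{-r} converge once r exceeds the rank; rank + 1 is the first such integer.
  have hs := ZLattice.summable_norm_zpow L (-((Module.finrank ℤ L + 1 : ℕ) : ℤ)) (by push_cast; omega)
  have hmem (ξ : Fin n → ℤ) : (fun i => (ξ i : ℝ)) ∈ L := by
    rw [hL, (Pi.basisFun ℝ (Fin n)).mem_span_iff_repr_mem ℤ]
    intro i
    exact ⟨ξ i, by simp⟩
  refine ⟨Module.finrank ℤ L, ?_⟩
  have hinj : Function.Injective fun ξ : Fin n → ℤ => (⟨_, hmem ξ⟩ : L) := by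
    intro ξ η h
    ext i
    have := congrFun (congrArg Subtype.val h) i
    exact Int.cast_injective (α := ℝ) this
  refine (hs.comp_injective hinj).congr fun ξ => ?_
  simp only [Function.comp_apply, zpow_neg, zpow_natCast]
  rfl

theorem isTorusSmooth_mFourierSMul (ξ : Fin n → ℤ) (v : H) :
    IsTorusSmooth (mFourierSMul ξ v) := by
  unfold IsTorusSmooth
  simp only [mFourierSMul_apply, mFourier_apply_coe]
  refine ContDiff.smul (ContDiff.cexp (contDiff_const.mul (ContDiff.sum fun i _ => contDiff_const.mul
    (Complex.ofRealCLM.contDiff.comp (contDiff_apply ℝ ℝ i))))) contDiff_const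

namespace IsTorusSmooth

variable {f : UnitAddTorus (Fin n) → H}

theorem continuous (hf : IsTorusSmooth f) : Continuous f :=
  isOpenQuotientMap_coe.isQuotientMap.continuous_iff.mpr (ContDiff.continuous hf)

theorem coordDeriv_coe (hf : IsTorusSmooth f) (j : Fin n) (y : Fin n → ℝ) :
    coordDeriv j f (fun i => (y i : UnitAddCircle)) =
      fderiv ℝ (fun y : Fin n → ℝ => f fun i => (y i : UnitAddCircle)) y (Pi.single j 1) := by
  have hd := (ContDiff.differentiable hf (by simp) y).hasFDerivAt
  have hd' := hd.hasLineDerivAt (Pi.single j 1)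
  simp only [coordDeriv, coe_add_single]
  exact hd'.deriv

theorem coordDeriv (hf : IsTorusSmooth f) (j : Fin n) : IsTorusSmooth (coordDeriv j f) := by
  unfold IsTorusSmooth
  simp only [hf.coordDeriv_coe]
  exact (ContDiff.fderiv_right (m := ∞) hf (by simp)).clm_apply contDiff_const

theorem hasDerivAt_coordDeriv (hf : IsTorusSmooth f) (j : Fin n) (x : UnitAddTorus (Fin n)) (t : ℝ) :
    HasDerivAt (fun t : ℝ => f (x + Pi.single j (t : UnitAddCircle)))
      (UnitAddTorus.coordDeriv j f (x + Pi.single j (t : UnitAddCircle))) t := by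
  obtain ⟨y, rfl⟩ := isOpenQuotientMap_coe.surjective x
  simp only [coe_add_single]
  rw [hf.coordDeriv_coe]
  have hd := (ContDiff.differentiable hf (by simp) (y + t • Pi.single j 1)).hasFDerivAt
  have hl : HasDerivAt (fun t : ℝ => y + t • (Pi.single j (1 : ℝ) : Fin n → ℝ)) (Pi.single j 1) t := by
    simpa using ((hasDerivAt_id t).smul_const (Pi.single j (1 : ℝ) : Fin n → ℝ)).const_add y
  exact hd.comp_hasDerivAt t hl

theorem exists_bound (hf : IsTorusSmooth f) : ∃ C, ∀ x, ‖f x‖ ≤ C := by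
  obtain ⟨C, hC⟩ := isCompact_univ.exists_bound_of_continuousOn hf.continuous.continuousOn
  exact ⟨C, fun x => hC x trivial⟩

/-- The coefficient of the translate of `f` by t in direction j is e^{2πi ξⱼ t} f̂(ξ). Its
derivative at t = 0 is computed once under the integral sign and once from the exponential. -/
theorem mFourierCoeff_coordDeriv (hf : IsTorusSmooth f) (j : Fin n) (ξ : Fin n → ℤ) :
    mFourierCoeff (UnitAddTorus.coordDeriv j f) ξ =
      (2 * Real.pi * Complex.I * ξ j : ℂ) • mFourierCoeff f ξ := by
  obtain ⟨C, hC⟩ := (hf.coordDeriv j).exists_bound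
  have hcont (g : UnitAddTorus (Fin n) → H) (hg : Continuous g) (t : ℝ) :
      Continuous fun x => mFourier (-ξ) x • g (x + Pi.single j (t : UnitAddCircle)) := by
    fun_prop
  have h1 : HasDerivAt (fun t : ℝ => ∫ x, mFourier (-ξ) x • f (x + Pi.single j (t : UnitAddCircle))
      ∂(torusMeasure n)) (∫ x, mFourier (-ξ) x •
        UnitAddTorus.coordDeriv j f (x + Pi.single j ((0 : ℝ) : UnitAddCircle)) ∂(torusMeasure n)) 0 := by
    refine (hasDerivAt_integral_of_dominated_loc_of_deriv_le (bound := fun _ => C)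
      (F' := fun (t : ℝ) x => mFourier (-ξ) x •
        UnitAddTorus.coordDeriv j f (x + Pi.single j (t : UnitAddCircle)))
      Filter.univ_mem ?_ ?_ ?_ ?_ ?_ ?_).2
    · exact .of_forall fun t => (hcont f hf.continuous t).aestronglyMeasurable
    · exact (hcont f hf.continuous 0).integrable_of_hasCompactSupport (.of_compactSpace _)
    · exact (hcont _ (hf.coordDeriv j).continuous 0).aestronglyMeasurable
    · refine .of_forall fun x t _ => ?_
      rw [norm_smul, norm_mFourier_apply, one_mul]
      exact hC _
    · exact integrable_const _
    · exact .of_forall fun x t _ => (hf.hasDerivAt_coordDeriv j x t).const_smul _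
  have h2 (t : ℝ) : ∫ x, mFourier (-ξ) x • f (x + Pi.single j (t : UnitAddCircle))
      ∂(torusMeasure n) = Complex.exp (2 * Real.pi * Complex.I * ξ j * t) • mFourierCoeff f ξ := by
    refine (mFourierCoeff_translate f ξ (Pi.single j (t : UnitAddCircle))).trans ?_
    congr 1
    have : (Pi.single j (t : UnitAddCircle) : UnitAddTorus (Fin n)) =
        fun i => ((Pi.single j t : Fin n → ℝ) i : UnitAddCircle) := by
      ext i
      by_cases h : i = j
      · subst h; simp
      · simp [h]
    rw [this, mFourier_apply_coe, Finset.sum_eq_single j]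
    · simp [mul_assoc]
    · intro i _ hi; simp [hi]
    · simp
  simp only [h2] at h1
  have h3 : HasDerivAt (fun t : ℝ => Complex.exp (2 * Real.pi * Complex.I * ξ j * t))
      (2 * Real.pi * Complex.I * ξ j : ℂ) 0 := by
    have := ((Complex.ofRealCLM.hasDerivAt (x := (0 : ℝ))).const_mul
      (2 * Real.pi * Complex.I * ξ j : ℂ)).cexp
    simpa using this
  have h4 := h1.unique (h3.smul_const (mFourierCoeff f ξ))
  rw [← h4, mFourierCoeff_eq]
  simp

/-- Each coordinate derivative brings out a factor 2π|ξⱼ| ≥ |ξⱼ|, and derivatives of smooth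
functions are again bounded. -/
theorem norm_pow_mul_mFourierCoeff_le (hf : IsTorusSmooth f) (j : Fin n) (m : ℕ) :
    ∃ C, ∀ ξ : Fin n → ℤ, |(ξ j : ℝ)| ^ m * ‖mFourierCoeff f ξ‖ ≤ C := by
  induction m generalizing f with
  | zero =>
    obtain ⟨C, hC⟩ := hf.exists_bound
    exact ⟨C, fun ξ => by simpa using norm_mFourierCoeff_le f ξ hC⟩
  | succ m ih =>
    obtain ⟨C, hC⟩ := ih (hf.coordDeriv j)
    refine ⟨C, fun ξ => le_trans ?_ (hC ξ)⟩
    rw [hf.mFourierCoeff_coordDeriv, norm_smul, pow_succ, mul_assoc]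
    gcongr
    have : ‖(2 * Real.pi * Complex.I * ξ j : ℂ)‖ = 2 * Real.pi * |(ξ j : ℝ)| := by
      simp [abs_of_pos Real.pi_pos]
    rw [this]
    have := Real.pi_gt_three
    nlinarith [abs_nonneg (ξ j : ℝ)]

theorem summable_norm_mFourierCoeff (hf : IsTorusSmooth f) :
    Summable fun ξ => ‖mFourierCoeff f ξ‖ := by
  obtain ⟨m, hm⟩ := exists_summable_norm_pow_inv n
  choose C hC using fun j => hf.norm_pow_mul_mFourierCoeff_le j (m + 1)
  refine Summable.of_norm_bounded_eventually (hm.mul_left (∑ j, |C j|)) ?_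
  -- The majorant is 0 at ξ = 0, because `0⁻¹ = 0`, so this frequency is discarded. Elsewhere the
  -- coordinate attaining the sup norm supplies the decay.
  filter_upwards [(Set.finite_singleton (0 : Fin n → ℤ)).compl_mem_cofinite] with ξ hξ
  obtain ⟨i, hi⟩ := Function.ne_iff.mp hξ
  have : Nonempty (Fin n) := ⟨i⟩
  obtain ⟨j, hj⟩ := exists_norm_apply_eq (fun i => (ξ i : ℝ))
  have hpos : 0 < ‖fun i => (ξ i : ℝ)‖ :=
    norm_pos_iff.mpr fun h => hi (by simpa using congrFun h i)
  rw [norm_norm, ← div_eq_mul_inv, le_div_iff₀ (by positivity), mul_comm, ← hj]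
  calc _ ≤ C j := hC j ξ
    _ ≤ |C j| := le_abs_self _
    _ ≤ _ := Finset.single_le_sum (f := fun j => |C j|) (fun _ _ => abs_nonneg _) (Finset.mem_univ j)

/-- The Fourier series of a smooth function on the torus converges to it uniformly. -/
theorem hasSum_mFourier_series [CompleteSpace H] {f : C(UnitAddTorus (Fin n), H)}
    (hf : IsTorusSmooth f) :
    HasSum (fun ξ => mFourierSMul ξ (mFourierCoeff f ξ)) f := by
  have hs : Summable fun ξ => mFourierSMul ξ (mFourierCoeff f ξ) := by
    refine .of_norm_bounded hf.summable_norm_mFourierCoeff fun ξ => ?_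
    refine (ContinuousMap.norm_le _ (norm_nonneg _)).mpr fun x => ?_
    simp [norm_smul, norm_mFourier_apply]
  convert hs.hasSum
  ext x
  -- The sum exists by absolute convergence; functionals identify it with `f` through scalar Fourier
  -- inversion.
  refine (SeparatingDual.eq_iff_forall_dual_eq (R := ℂ)).mpr fun ℓ => ?_
  have hx := (ContinuousMap.evalCLM ℂ x).hasSum hs.hasSum
  have hx' := ℓ.hasSum hx
  have hcoeff (ξ : Fin n → ℤ) : mFourierCoeff (fun x => ℓ (f x)) ξ = ℓ (mFourierCoeff f ξ) := by
    rw [mFourierCoeff_eq, mFourierCoeff_eq, ← ContinuousLinearMap.integral_comp_comm]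
    · simp
    · exact Continuous.integrable_of_hasCompactSupport (by fun_prop) (.of_compactSpace _)
  have hℓ := hasSum_mFourier_series_apply_of_summable (f := ⟨fun x => ℓ (f x), by fun_prop⟩)
    (Summable.of_norm ?_) x
  · refine hℓ.unique ?_
    simp only [ContinuousMap.coe_mk, hcoeff]
    convert! hx' using 2 with ξ
    simp [mul_comm]
  · simp only [ContinuousMap.coe_mk, hcoeff]
    exact .of_nonneg_of_le (fun _ => norm_nonneg _) (fun ξ => ℓ.le_opNorm _)
      (hf.summable_norm_mFourierCoeff.mul_left _)

end IsTorusSmooth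


/-! ### Norms and inclusions of vector-valued L^p spaces -/

namespace MeasureTheory.Lp

variable {α : Type*} [MeasurableSpace α] {μ : Measure α}
  {H : Type*} [NormedAddCommGroup H] {p q : ℝ≥0∞} [Fact (1 ≤ p)]

theorem norm_rpow_toReal_eq_integral (hp : p ≠ ⊤) (f : Lp H p μ) :
    ‖f‖ ^ p.toReal = ∫ x, ‖f x‖ ^ p.toReal ∂μ := by
  have h1 : p ≠ 0 := (zero_lt_one.trans_le (Fact.out : 1 ≤ p)).ne'
  have hr : p.toReal ≠ 0 := ENNReal.toReal_ne_zero.mpr ⟨h1, hp⟩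
  have h0 : 0 ≤ ∫ x, ‖f x‖ ^ p.toReal ∂μ := integral_nonneg fun x => by positivity
  rw [norm_def, (Lp.memLp f).eLpNorm_eq_integral_rpow_norm h1 hp,
    ENNReal.toReal_ofReal (by positivity), Real.rpow_inv_rpow h0 hr]

theorem integrable_norm_rpow_toReal (hp : p ≠ ⊤) (f : Lp H p μ) :
    Integrable (fun x => ‖f x‖ ^ p.toReal) μ :=
  (Lp.memLp f).integrable_norm_rpow (zero_lt_one.trans_le (Fact.out : 1 ≤ p)).ne' hp

/-- The inclusion of `L^q` into `L^p` for `p ≤ q` over a probability measure. -/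
def inclusionOfLE (𝕜 : Type*) [NontriviallyNormedField 𝕜] [NormedSpace 𝕜 H] [IsProbabilityMeasure μ]
    [Fact (1 ≤ q)] (h : p ≤ q) : Lp H q μ →L[𝕜] Lp H p μ :=
  LinearMap.mkContinuous
    { toFun := fun f => ((Lp.memLp f).mono_exponent h).toLp f
      map_add' := fun f g => by
        rw [← MemLp.toLp_add]
        exact MemLp.toLp_congr _ _ (Lp.coeFn_add f g)
      map_smul' := fun c f => by
        rw [RingHom.id_apply, ← MemLp.toLp_const_smul]
        exact MemLp.toLp_congr _ _ (Lp.coeFn_smul c f) } 1 fun f => by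
    rw [one_mul]
    refine (Lp.norm_toLp f ((Lp.memLp f).mono_exponent h)).trans_le ?_
    rw [Lp.norm_def]
    exact ENNReal.toReal_mono (Lp.eLpNorm_ne_top f)
      (eLpNorm_le_eLpNorm_of_exponent_le h (Lp.aestronglyMeasurable f))

theorem coeFn_inclusionOfLE (𝕜 : Type*) [NontriviallyNormedField 𝕜] [NormedSpace 𝕜 H]
    [IsProbabilityMeasure μ] [Fact (1 ≤ q)] (h : p ≤ q) (f : Lp H q μ) :
    inclusionOfLE 𝕜 h f =ᵐ[μ] f :=
  MemLp.coeFn_toLp ((Lp.memLp f).mono_exponent h)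

end MeasureTheory.Lp

/-! ### Clarkson's inequality and the variational problem -/

section Clarkson

variable {H : Type*} [NormedAddCommGroup H] [InnerProductSpace ℂ H]

/-- Clarkson's inequality for exponents `r ≥ 2` in a Hilbert space. -/
theorem clarkson_inequality {r : ℝ} (hr : 2 ≤ r) (a b : H) :
    ‖(2⁻¹ : ℂ) • (a + b)‖ ^ r + ‖(2⁻¹ : ℂ) • (a - b)‖ ^ r ≤ (‖a‖ ^ r + ‖b‖ ^ r) / 2 := by
  have hsq (t : ℝ) (ht : 0 ≤ t) : t ^ r = (t ^ 2) ^ (r / 2) := by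
    rw [← Real.rpow_natCast_mul ht]; congr 1; push_cast; ring
  have hpar := parallelogram_law_with_norm ℂ a b
  have hu : ‖(2⁻¹ : ℂ) • (a + b)‖ ^ 2 + ‖(2⁻¹ : ℂ) • (a - b)‖ ^ 2 =
      (1 / 2) * ‖a‖ ^ 2 + (1 / 2) * ‖b‖ ^ 2 := by
    simp only [norm_smul, norm_inv, Complex.norm_ofNat]
    linarith
  rw [hsq _ (norm_nonneg _), hsq _ (norm_nonneg _), hsq ‖a‖ (norm_nonneg _),
    hsq ‖b‖ (norm_nonneg _)]
  -- Superadditivity of t ↦ t^{r/2} merges the left side, the parallelogram law evaluates the merged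
  -- sum, and convexity of the same power finishes.
  refine (Real.add_rpow_le_rpow_add (by positivity) (by positivity) (by linarith)).trans ?_
  rw [hu]
  have hc := (convexOn_rpow (p := r / 2) (by linarith : (1 : ℝ) ≤ r / 2)).2 (Set.mem_Ici.mpr (sq_nonneg ‖a‖))
    (Set.mem_Ici.mpr (sq_nonneg ‖b‖)) 
    (by norm_num : (0 : ℝ) ≤ 1 / 2) (by norm_num : (0 : ℝ) ≤ 1 / 2) (by norm_num)
  simp only [smul_eq_mul] at hc
  linarith

theorem MeasureTheory.Lp.clarkson_inequality {α : Type*} [MeasurableSpace α] {μ : Measure α}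
    {p : ℝ≥0∞} [Fact (1 ≤ p)] (hp : p ≠ ⊤) (hp2 : 2 ≤ p) (f g : Lp H p μ) :
    ‖(2⁻¹ : ℂ) • (f + g)‖ ^ p.toReal + ‖(2⁻¹ : ℂ) • (f - g)‖ ^ p.toReal ≤
      (‖f‖ ^ p.toReal + ‖g‖ ^ p.toReal) / 2 := by
  have hr : 2 ≤ p.toReal := by simpa using ENNReal.toReal_mono hp hp2
  simp only [norm_rpow_toReal_eq_integral hp]
  rw [← integral_add (integrable_norm_rpow_toReal hp _) (integrable_norm_rpow_toReal hp _),
    ← integral_add (integrable_norm_rpow_toReal hp _) (integrable_norm_rpow_toReal hp _),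
    ← integral_div]
  refine integral_mono_ae ((integrable_norm_rpow_toReal hp _).add (integrable_norm_rpow_toReal hp _))
    (((integrable_norm_rpow_toReal hp _).add (integrable_norm_rpow_toReal hp _)).div_const 2) ?_
  filter_upwards [Lp.coeFn_smul (2⁻¹ : ℂ) (f + g), Lp.coeFn_smul (2⁻¹ : ℂ) (f - g),
    Lp.coeFn_add f g, Lp.coeFn_sub f g] with x h1 h2 h3 h4
  simp only [h1, h2, h3, h4, Pi.smul_apply, Pi.add_apply, Pi.sub_apply]
  exact _root_.clarkson_inequality hr _ _

end Clarkson

/-- In a Banach space satisfying Clarkson's inequality with exponent `r`, the functional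
`‖f‖ ^ r / r - Re (φ f)` attains its minimum. -/
theorem exists_forall_norm_rpow_sub_re_le {E : Type*} [NormedAddCommGroup E] [NormedSpace ℂ E]
    [CompleteSpace E] {r : ℝ} (hr : 1 < r)
    (hE : ∀ f g : E, ‖(2⁻¹ : ℂ) • (f + g)‖ ^ r + ‖(2⁻¹ : ℂ) • (f - g)‖ ^ r ≤
      (‖f‖ ^ r + ‖g‖ ^ r) / 2) (φ : E →L[ℂ] ℂ) :
    ∃ f : E, ∀ h : E, ‖f‖ ^ r / r - (φ f).re ≤ ‖h‖ ^ r / r - (φ h).re := by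
  have hr0 : 0 < r := by linarith
  set J : E → ℝ := fun f => ‖f‖ ^ r / r - (φ f).re with hJ
  have hJc : Continuous J := by
    refine .sub (.div_const (.rpow_const continuous_norm fun _ => .inr hr0.le) _) ?_
    exact Complex.continuous_re.comp φ.continuous
  have hbdd : BddBelow (Set.range J) := by
    -- Young's inequality bounds Re φ(f) ≤ ‖φ‖ ‖f‖ and supplies the lower bound.
    have hc := Real.HolderConjugate.conjExponent hr
    refine ⟨-(‖φ‖ ^ r.conjExponent / r.conjExponent), ?_⟩
    rintro _ ⟨f, rfl⟩
    have h1 := Real.young_inequality_of_nonneg (norm_nonneg f) (norm_nonneg φ) hc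
    have h2 : (φ f).re ≤ ‖φ‖ * ‖f‖ := (Complex.re_le_norm _).trans (φ.le_opNorm f)
    simp only [hJ]
    linarith
  set m := sInf (Set.range J) with hm
  have hmle (f : E) : m ≤ J f := csInf_le hbdd ⟨f, rfl⟩
  -- The midpoint of `f` and `g` has `J` at least `m`, so Clarkson bounds their distance by how far
  -- `J f` and `J g` exceed `m`. Minimising sequences are therefore Cauchy.
  have hkey (f g : E) : ‖(2⁻¹ : ℂ) • (f - g)‖ ^ r ≤ r * ((J f + J g) / 2 - m) := by
    have h1 := hE f g
    have h2 := hmle ((2⁻¹ : ℂ) • (f + g))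
    have h3 : (φ ((2⁻¹ : ℂ) • (f + g))).re = ((φ f).re + (φ g).re) / 2 := by
      rw [map_smul, map_add, smul_eq_mul, show (2⁻¹ : ℂ) = ((2⁻¹ : ℝ) : ℂ) by simp,
        Complex.re_ofReal_mul, Complex.add_re]
      ring
    simp only [hJ, h3] at h2 ⊢
    rw [le_sub_iff_add_le, le_div_iff₀ hr0] at h2
    field_simp
    linarith
  have hex (k : ℕ) : ∃ f, J f < m + 1 / (k + 1) := by
    obtain ⟨_, ⟨f, rfl⟩, hf⟩ := exists_lt_of_csInf_lt (Set.range_nonempty J)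
      (lt_add_of_pos_right m (Nat.one_div_pos_of_nat (n := k) (α := ℝ)))
    exact ⟨f, hf⟩
  choose u hu using hex
  have hcauchy : CauchySeq u := by
    refine Metric.cauchySeq_iff'.mpr fun ε hε => ?_
    obtain ⟨N, hN⟩ := exists_nat_one_div_lt (show 0 < (ε / 2) ^ r / r by positivity)
    refine ⟨N, fun k hk => ?_⟩
    have h1 := hkey (u k) (u N)
    have h2 : (1 : ℝ) / (k + 1) ≤ 1 / (N + 1) := Nat.one_div_le_one_div hk
    have h3 : ‖(2⁻¹ : ℂ) • (u k - u N)‖ ^ r < (ε / 2) ^ r := by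
      refine h1.trans_lt ?_
      rw [lt_div_iff₀ hr0, mul_comm] at hN
      refine lt_of_le_of_lt (mul_le_mul_of_nonneg_left ?_ hr0.le) hN
      linarith [hu k, hu N]
    have h4 := (Real.rpow_lt_rpow_iff (norm_nonneg _) (by positivity) hr0).mp h3
    rw [norm_smul, norm_inv, Complex.norm_ofNat] at h4
    rw [dist_eq_norm]
    linarith
  obtain ⟨f, hf⟩ := cauchySeq_tendsto_of_complete hcauchy
  refine ⟨f, fun h => le_trans ?_ (hmle h)⟩
  have ht : Filter.Tendsto (fun k : ℕ => m + 1 / ((k : ℝ) + 1)) Filter.atTop (nhds (m + 0)) :=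
    tendsto_const_nhds.add tendsto_one_div_add_atTop_nhds_zero_nat
  rw [add_zero] at ht
  exact le_of_tendsto_of_tendsto' ((hJc.tendsto f).comp hf) ht fun k => (hu k).le

/-- This is the Euler–Lagrange equation of the minimiser in the direction `h`. -/
theorem re_apply_eq_of_forall_norm_rpow_sub_re_le {E : Type*} [NormedAddCommGroup E]
    [NormedSpace ℂ E] {r : ℝ} {φ : E →L[ℂ] ℂ} {f : E}
    (hf : ∀ h : E, ‖f‖ ^ r / r - (φ f).re ≤ ‖h‖ ^ r / r - (φ h).re) (h : E) {D : ℝ}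
    (hD : HasDerivAt (fun t : ℝ => ‖f + (t : ℂ) • h‖ ^ r) D 0) : (φ h).re = D / r := by
  have h2 : HasDerivAt (fun t : ℝ => (φ (f + (t : ℂ) • h)).re) (φ h).re 0 := by
    have : (fun t : ℝ => (φ (f + (t : ℂ) • h)).re) = fun t : ℝ => (φ f).re + t * (φ h).re := by
      ext t
      rw [map_add, map_smul, smul_eq_mul, Complex.add_re, Complex.re_ofReal_mul]
    rw [this]
    simpa using ((hasDerivAt_id (0 : ℝ)).mul_const (φ h).re).const_add (φ f).re
  have hmin : IsLocalMin (fun t : ℝ => ‖f + (t : ℂ) • h‖ ^ r / r - (φ (f + (t : ℂ) • h)).re) 0 := by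
    refine .of_forall fun t => ?_
    simp only [Complex.ofReal_zero, zero_smul, add_zero]
    exact hf _
  exact (sub_eq_zero.mp (hmin.hasDerivAt_eq_zero ((hD.div_const r).sub h2))).symm

theorem ENNReal.HolderConjugate.mul_ofReal_toReal_sub_one {p q : ℝ≥0∞} [p.HolderConjugate q]
    (hp : p ≠ ⊤) (hq : q ≠ ⊤) : q * ENNReal.ofReal (p.toReal - 1) = p := by
  have h1 := ENNReal.HolderConjugate.sub_one_mul_inv p q hp
  have h2 : ENNReal.ofReal (p.toReal - 1) = p - 1 := by
    rw [ENNReal.ofReal_sub _ zero_le_one, ENNReal.ofReal_toReal hp, ENNReal.ofReal_one]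
  have hp0 : p ≠ 0 := ENNReal.HolderConjugate.ne_zero p q
  have hq0 : q ≠ 0 := ENNReal.HolderConjugate.ne_zero q p
  calc q * ENNReal.ofReal (p.toReal - 1) = q * ((p - 1) * (p⁻¹ * p)) := by
        rw [h2, ENNReal.inv_mul_cancel hp0 hp, mul_one]
    _ = q * q⁻¹ * p := by rw [← mul_assoc (p - 1), h1, mul_assoc]
    _ = p := by rw [ENNReal.mul_inv_cancel hq0 hq, one_mul]

/-- The element of `L^q(H')` dual to `f ∈ L^p(H)`, namely `‖f‖ ^ (p - 2) ⟪f, ·⟫`. -/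
theorem exists_lp_dual_norm_rpow_smul {α : Type*} [MeasurableSpace α]
    {μ : Measure α} {H : Type*} [NormedAddCommGroup H] [InnerProductSpace ℂ H] [CompleteSpace H]
    {p q : ℝ≥0∞} [p.HolderConjugate q] (hp : p ≠ ⊤) (hp2 : 2 ≤ p) (f : Lp H p μ) :
    ∃ G : Lp (StrongDual ℂ H) q μ, ‖G‖ = ‖f‖ ^ (p.toReal - 1) ∧ ∀ᵐ x ∂μ, ∀ v : H,
      G x v = ((‖f x‖ ^ (p.toReal - 2) : ℝ) : ℂ) * inner ℂ (f x) v := by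
  have hr : 2 ≤ p.toReal := by simpa using ENNReal.toReal_mono hp hp2
  set r := p.toReal with hrdef
  have hq : q ≠ ⊤ := fun h => by
    rw [(ENNReal.HolderConjugate.eq_top_iff_eq_one q p).mp h] at hp2
    norm_num at hp2
  have hqr : q * ENNReal.ofReal (r - 1) = p  :=
    ENNReal.HolderConjugate.mul_ofReal_toReal_sub_one hp hq
  set G₀ : α → StrongDual ℂ H :=
    fun x => InnerProductSpace.toDual ℂ H (((‖f x‖ ^ (r - 2) : ℝ) : ℂ) • f x) with hG₀
  have hnorm (x : α) : ‖G₀ x‖ = ‖f x‖ ^ (r - 1) := by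
    simp only [hG₀, LinearIsometryEquiv.norm_map, norm_smul, Complex.norm_real]
    rw [Real.norm_of_nonneg (by positivity)]
    nth_rewrite 2 [← Real.rpow_one ‖f x‖]
    rw [← Real.rpow_add_of_nonneg (norm_nonneg _) (by linarith) (by norm_num)]
    congr 1; ring
  have hG₀m : AEStronglyMeasurable G₀ μ := by
    refine (InnerProductSpace.toDual ℂ H).continuous.comp_aestronglyMeasurable ?_
    exact (Complex.continuous_ofReal.comp_aestronglyMeasurable
      ((Lp.aestronglyMeasurable f).norm.aemeasurable.pow_const _).aestronglyMeasurable).smul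
        (Lp.aestronglyMeasurable f)
  have hG₀e : eLpNorm G₀ q μ = eLpNorm f p μ ^ (r - 1) := by
    rw [← congrArg (fun t => eLpNorm f t μ) hqr, ← eLpNorm_norm_rpow f (by linarith)]
    refine eLpNorm_congr_norm_ae (.of_forall fun x => ?_)
    rw [hnorm, Real.norm_of_nonneg (by positivity)]
  have hG₀L : MemLp G₀ q μ := by
    refine ⟨hG₀m, ?_⟩
    rw [hG₀e]
    exact ENNReal.rpow_lt_top_of_nonneg (by linarith) (Lp.eLpNorm_ne_top f)
  refine ⟨hG₀L.toLp G₀, ?_, ?_⟩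
  · rw [Lp.norm_toLp, hG₀e, Lp.norm_def, ENNReal.toReal_rpow]
  · filter_upwards [hG₀L.coeFn_toLp] with x hx v
    rw [hx, InnerProductSpace.toDual_apply_apply, inner_smul_left, Complex.conj_ofReal]

/-! ### Duality of L^p(H) for 2 ≤ p < ∞ -/

section Duality

variable {α : Type*} [MeasurableSpace α] {μ : Measure α}
  {H : Type*} [NormedAddCommGroup H] [InnerProductSpace ℂ H] {p q : ℝ≥0∞} [Fact (1 ≤ p)]

theorem hasDerivAt_norm_add_smul_rpow {r : ℝ} (hr : 1 < r) (a b : H) (t : ℝ) :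
    HasDerivAt (fun t : ℝ => ‖a + (t : ℂ) • b‖ ^ r)
      (r * ‖a + (t : ℂ) • b‖ ^ (r - 2) * (inner ℂ (a + (t : ℂ) • b) b).re) t := by
  let _ : InnerProductSpace ℝ H := InnerProductSpace.complexToReal
  have h1 : HasDerivAt (fun t : ℝ => a + (t : ℂ) • b) b t := by
    simpa using ((Complex.ofRealCLM.hasDerivAt (x := t)).smul_const b).const_add a
  have h2 := (hasFDerivAt_norm_rpow (a + (t : ℂ) • b) hr).comp_hasDerivAt t h1
  convert! h2 using 1

theorem norm_rpow_sub_two_mul_inner_self_re {r : ℝ} (hr : 2 ≤ r) (a : H) :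
    ‖a‖ ^ (r - 2) * (inner ℂ a a).re = ‖a‖ ^ r := by
  rw [← RCLike.re_eq_complex_re, inner_self_eq_norm_sq, ← Real.rpow_natCast,
    ← Real.rpow_add_of_nonneg (norm_nonneg _) (by linarith) (by norm_num)]
  norm_num

theorem norm_rpow_sub_two_mul_le {r : ℝ} (hr : 2 ≤ r) (a b : H) {t : ℝ} (ht : |t| ≤ 1) :
    |r * ‖a + (t : ℂ) • b‖ ^ (r - 2) * (inner ℂ (a + (t : ℂ) • b) b).re| ≤
      r * (‖a‖ + ‖b‖) ^ r := by
  have h0 : ‖a + (t : ℂ) • b‖ ≤ ‖a‖ + ‖b‖ := by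
    refine (norm_add_le _ _).trans ?_
    rw [norm_smul, Complex.norm_real, Real.norm_eq_abs]
    gcongr
    exact mul_le_of_le_one_left (norm_nonneg _) ht
  have h1 : |(inner ℂ (a + (t : ℂ) • b) b).re| ≤ (‖a‖ + ‖b‖) ^ 2 := by
    refine (Complex.abs_re_le_norm _).trans ((norm_inner_le_norm _ _).trans ?_)
    rw [sq]
    gcongr
    linarith [norm_nonneg a]
  rw [abs_mul, abs_mul, abs_of_nonneg (by linarith : (0 : ℝ) ≤ r),
    abs_of_nonneg (Real.rpow_nonneg (norm_nonneg _) _), mul_assoc]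
  have h2 : (‖a‖ + ‖b‖) ^ r = (‖a‖ + ‖b‖) ^ (r - 2) * (‖a‖ + ‖b‖) ^ 2 := by
    rw [← Real.rpow_natCast, ← Real.rpow_add_of_nonneg (by positivity) (by linarith) (by norm_num)]
    norm_num
  rw [h2]
  gcongr

theorem MeasureTheory.Lp.hasDerivAt_norm_add_smul_rpow (hp : p ≠ ⊤) (hp2 : 2 ≤ p) (f h : Lp H p μ) :
    HasDerivAt (fun t : ℝ => ‖f + (t : ℂ) • h‖ ^ p.toReal)
      (∫ x, p.toReal * ‖f x‖ ^ (p.toReal - 2) * (inner ℂ (f x) (h x)).re ∂μ) 0 := by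
  have hr : 2 ≤ p.toReal := by simpa using ENNReal.toReal_mono hp hp2
  have heq (t : ℝ) : ‖f + (t : ℂ) • h‖ ^ p.toReal =
      ∫ x, ‖f x + (t : ℂ) • h x‖ ^ p.toReal ∂μ := by
    rw [norm_rpow_toReal_eq_integral hp]
    refine integral_congr_ae ?_
    filter_upwards [Lp.coeFn_add f ((t : ℂ) • h), Lp.coeFn_smul (t : ℂ) h] with x h1 h2
    rw [h1, Pi.add_apply, h2, Pi.smul_apply]
  simp only [heq]
  have hfm := Lp.aestronglyMeasurable f
  have hhm := Lp.aestronglyMeasurable h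
  have hsum : MemLp (fun x => ‖f x‖ + ‖h x‖) p μ := (Lp.memLp f).norm.add (Lp.memLp h).norm
  have hmain := (hasDerivAt_integral_of_dominated_loc_of_deriv_le (μ := μ) (x₀ := (0 : ℝ))
    (F := fun (t : ℝ) x => ‖f x + (t : ℂ) • h x‖ ^ p.toReal)
    (F' := fun (t : ℝ) x => p.toReal * ‖f x + (t : ℂ) • h x‖ ^ (p.toReal - 2) *
      (inner ℂ (f x + (t : ℂ) • h x) (h x)).re)
    (bound := fun x => p.toReal * (‖f x‖ + ‖h x‖) ^ p.toReal)
    -- The radius 1 is the range |t| ≤ 1 in which `norm_rpow_sub_two_mul_le` gives an integrable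
    -- majorant independent of t.
    (Metric.closedBall_mem_nhds 0 one_pos) ?_ ?_ ?_ ?_ ?_ ?_).2
  · simpa using hmain
  · exact .of_forall fun t => ((hfm.add (hhm.const_smul (t : ℂ))).norm.aemeasurable.pow_const
      _).aestronglyMeasurable
  · simpa using integrable_norm_rpow_toReal hp f
  · have h1 : AEStronglyMeasurable (fun x => f x + ((0 : ℝ) : ℂ) • h x) μ :=
      hfm.add (hhm.const_smul _)
    exact ((h1.norm.aemeasurable.pow_const _).aestronglyMeasurable.const_mul _).mul
      (Complex.continuous_re.comp_aestronglyMeasurable (h1.inner hhm))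
  · refine .of_forall fun x t ht => ?_
    exact norm_rpow_sub_two_mul_le hr _ _ (by simpa using ht)
  · have := hsum.integrable_norm_rpow (zero_lt_one.trans_le (Fact.out : 1 ≤ p)).ne' hp
    refine Integrable.const_mul (this.congr (.of_forall fun x => ?_)) _
    simp only [Real.norm_eq_abs]
    rw [abs_of_nonneg (by positivity)]
  · exact .of_forall fun x t _ => _root_.hasDerivAt_norm_add_smul_rpow (by linarith) _ _ _

variable [Fact (1 ≤ q)] [p.HolderConjugate q]

/-- Every `G ∈ L^q(H')` is a bounded functional on `L^p(H)`. -/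
theorem exists_clm_eq_integral (G : Lp (StrongDual ℂ H) q μ) :
    ∃ ψ : Lp H p μ →L[ℂ] ℂ, ∀ h : Lp H p μ,
      Integrable (fun x => G x (h x)) μ ∧ ψ h = ∫ x, G x (h x) ∂μ := by
  refine ⟨(ContinuousLinearMap.id ℂ (StrongDual ℂ H)).lpPairing μ q p G, fun h => ⟨?_, ?_⟩⟩
  · exact memLp_one_iff_integrable.mp ((ContinuousLinearMap.id ℂ (StrongDual ℂ H)).memLp_of_bilin 1
      (Lp.memLp G) (Lp.memLp h))
  · exact ContinuousLinearMap.lpPairing_eq_integral _ _ _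

variable [CompleteSpace H]

theorem exists_forall_re_eq_integral_inner (hp : p ≠ ⊤) (hp2 : 2 ≤ p) (φ : Lp H p μ →L[ℂ] ℂ) :
    ∃ f : Lp H p μ, ∀ h : Lp H p μ,
      (φ h).re = ∫ x, ‖f x‖ ^ (p.toReal - 2) * (inner ℂ (f x) (h x)).re ∂μ := by
  have hr : 2 ≤ p.toReal := by simpa using ENNReal.toReal_mono hp hp2
  have hC := fun f g : Lp H p μ => Lp.clarkson_inequality hp hp2 f g
  obtain ⟨f, hf⟩ := exists_forall_norm_rpow_sub_re_le (by linarith) hC φ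
  refine ⟨f, fun h => ?_⟩
  rw [re_apply_eq_of_forall_norm_rpow_sub_re_le hf h
    (Lp.hasDerivAt_norm_add_smul_rpow hp hp2 f h), ← integral_div]
  refine integral_congr_ae (.of_forall fun x => ?_)
  field_simp

theorem exists_lp_dual_repr_of_two_le (hp : p ≠ ⊤) (hp2 : 2 ≤ p) (φ : Lp H p μ →L[ℂ] ℂ) :
    ∃ G : Lp (StrongDual ℂ H) q μ, ‖G‖ ≤ ‖φ‖ ∧ ∀ f : Lp H p μ, φ f = ∫ x, G x (f x) ∂μ := by
  have hr : 2 ≤ p.toReal := by simpa using ENNReal.toReal_mono hp hp2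
  obtain ⟨f, hf⟩ := exists_forall_re_eq_integral_inner hp hp2 φ
  obtain ⟨G, hGn, hG⟩ := exists_lp_dual_norm_rpow_smul (q := q) hp hp2 f
  obtain ⟨ψ, hψ⟩ := exists_clm_eq_integral (p := p) G
  have hre (h : Lp H p μ) : (φ h).re = (ψ h).re := by
    rw [hf, (hψ h).2, ← RCLike.re_eq_complex_re, ← integral_re (hψ h).1]
    refine integral_congr_ae ?_
    filter_upwards [hG] with x hx
    rw [hx, RCLike.re_eq_complex_re, Complex.re_ofReal_mul]
  -- Real parts determine a complex-linear functional: apply the equality to i h.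
  have heq (h : Lp H p μ) : φ h = ψ h := by
    refine Complex.ext (hre h) ?_
    have := hre (Complex.I • h)
    rw [map_smul, map_smul] at this
    simpa using this
  refine ⟨G, ?_, fun h => by rw [heq, (hψ h).2]⟩
  -- Evaluating at the minimiser gives ‖f‖^p ≤ ‖φ‖ ‖f‖, hence ‖G‖ = ‖f‖^{p-1} ≤ ‖φ‖.
  have hff : (φ f).re = ‖f‖ ^ p.toReal := by
    rw [hf, Lp.norm_rpow_toReal_eq_integral hp]
    congr 1
    ext x
    exact norm_rpow_sub_two_mul_inner_self_re hr _
  rw [hGn]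
  rcases (norm_nonneg f).eq_or_lt with h0 | h0
  · rw [← h0, Real.zero_rpow (by linarith)]
    exact norm_nonneg φ
  · have h1 : ‖f‖ ^ p.toReal ≤ ‖φ‖ * ‖f‖ := hff ▸ (Complex.re_le_norm _).trans (φ.le_opNorm f)
    rw [Real.rpow_sub_one h0.ne']
    exact (div_le_iff₀ h0).mpr h1

end Duality


/-! ### Duality of L^p(H) for 1 ≤ p ≤ 2 over a probability space -/

section Duality

variable {α : Type*} [MeasurableSpace α] {μ : Measure α} [IsProbabilityMeasure μ]
  {H : Type*} [NormedAddCommGroup H] [InnerProductSpace ℂ H] {p q : ℝ≥0∞} [Fact (1 ≤ p)]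

/-- The truncation to `{‖g‖ ≤ N}` of `‖g‖ ^ t • g` belongs to every `L^p`. -/
theorem memLp_indicator_norm_rpow_smul {g : α → H} (hg : StronglyMeasurable g) {t : ℝ} (ht : 0 ≤ t)
    (N : ℝ) (p : ℝ≥0∞) :
    MemLp ({x | ‖g x‖ ≤ N}.indicator fun x => ((‖g x‖ ^ t : ℝ) : ℂ) • g x) p μ := by
  have hA : MeasurableSet {x | ‖g x‖ ≤ N} := measurableSet_le hg.norm.measurable measurable_const
  have hm : AEStronglyMeasurable (fun x => ((‖g x‖ ^ t : ℝ) : ℂ) • g x) μ :=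
    (Complex.continuous_ofReal.comp_aestronglyMeasurable
      (hg.norm.measurable.pow_const t).aestronglyMeasurable).smul hg.aestronglyMeasurable
  refine MemLp.of_bound (hm.indicator hA) (|N| ^ t * |N|) (.of_forall fun x => ?_)
  by_cases hx : x ∈ {x | ‖g x‖ ≤ N}
  · rw [Set.indicator_of_mem hx, norm_smul, Complex.norm_real, Real.norm_of_nonneg (by positivity)]
    have hx' : ‖g x‖ ≤ |N| := le_trans hx (le_abs_self N)
    gcongr
  · rw [Set.indicator_of_notMem hx, norm_zero]
    positivity

theorem MeasureTheory.Lp.apply_toLp_eq_inner (hp2 : p ≤ 2) {φ : Lp H p μ →L[ℂ] ℂ} {g : Lp H 2 μ}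
    (hg : ∀ f : Lp H 2 μ, φ (Lp.inclusionOfLE ℂ hp2 f) = inner ℂ g f) {f : α → H}
    (hf : MemLp f p μ) (hf2 : MemLp f 2 μ) :
    φ (hf.toLp f) = ∫ x, inner ℂ (g x) (f x) ∂μ := by
  have h1 : hf.toLp f = Lp.inclusionOfLE ℂ hp2 (hf2.toLp f) := by
    refine Lp.ext ?_
    filter_upwards [hf.coeFn_toLp, Lp.coeFn_inclusionOfLE ℂ hp2 (hf2.toLp f), hf2.coeFn_toLp]
      with x h1 h2 h3
    rw [h1, h2, h3]
  rw [h1, hg, L2.inner_def]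
  refine integral_congr_ae ?_
  filter_upwards [hf2.coeFn_toLp] with x hx
  rw [hx]

/-- Testing φ on g restricted to A = {‖g‖ > ‖φ‖} gives ∫_A ‖g‖² ≤ ‖φ‖ ∫_A ‖g‖, whereas ‖g‖² > ‖φ‖
‖g‖ on A; so A is null. -/
theorem eLpNorm_top_le_of_riesz (hp2 : (1 : ℝ≥0∞) ≤ 2) {φ : Lp H 1 μ →L[ℂ] ℂ} {g : Lp H 2 μ}
    (hg : ∀ f : Lp H 2 μ, φ (Lp.inclusionOfLE ℂ hp2 f) = inner ℂ g f) :
    eLpNorm g ⊤ μ ≤ ENNReal.ofReal ‖φ‖ := by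
  have hgm := (Lp.stronglyMeasurable g).norm.measurable
  set A := {x | ‖φ‖ < ‖g x‖} with hAdef
  have hA : MeasurableSet A := measurableSet_lt measurable_const hgm
  have hgi : MemLp g 1 μ := (Lp.memLp g).mono_exponent hp2
  have hf1 : MemLp (A.indicator g) 1 μ := hgi.indicator hA
  have hf2 : MemLp (A.indicator g) 2 μ := (Lp.memLp g).indicator hA
  have h1 := Lp.apply_toLp_eq_inner hp2 hg hf1 hf2
  have hsq : Integrable (fun x => ‖g x‖ ^ 2) μ := (Lp.memLp g).integrable_norm_pow two_ne_zero
  have h2 : φ (hf1.toLp _) = ((∫ x in A, ‖g x‖ ^ 2 ∂μ : ℝ) : ℂ) := by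
    rw [h1, ← integral_indicator hA, ← integral_complex_ofReal]
    refine integral_congr_ae (.of_forall fun x => ?_)
    by_cases hx : x ∈ A
    · simp [hx]
    · simp [hx]
  have h3 : ‖hf1.toLp _‖ = ∫ x in A, ‖g x‖ ∂μ := by
    rw [L1.norm_eq_integral_norm, ← integral_indicator hA]
    refine integral_congr_ae ?_
    filter_upwards [hf1.coeFn_toLp] with x hx
    rw [hx, norm_indicator_eq_indicator_norm]
  have h4 := φ.le_opNorm (hf1.toLp _)
  rw [h2, h3, Complex.norm_real] at h4
  have hgn : Integrable (fun x => ‖φ‖ * ‖g x‖) μ :=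
    (memLp_one_iff_integrable.mp hgi).norm.const_mul _
  have hint : IntegrableOn (fun x => ‖g x‖ ^ 2 - ‖φ‖ * ‖g x‖) A μ := (hsq.sub hgn).integrableOn
  have h5 : ∫ x in A, (‖g x‖ ^ 2 - ‖φ‖ * ‖g x‖) ∂μ ≤ 0 := by
    rw [integral_sub hsq.integrableOn hgn.integrableOn,
      integral_const_mul]
    linarith [le_abs_self (∫ x in A, ‖g x‖ ^ 2 ∂μ), Real.norm_eq_abs (∫ x in A, ‖g x‖ ^ 2 ∂μ)]
  have h6 : μ A = 0 := by
    by_contra hne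
    have hpos (x : α) (hx : x ∈ A) : 0 < ‖g x‖ ^ 2 - ‖φ‖ * ‖g x‖ := by
      have hx' : ‖φ‖ < ‖g x‖ := hx
      have := norm_nonneg φ
      nlinarith
    refine h5.not_gt ((setIntegral_pos_iff_support_of_nonneg_ae ?_ hint).mpr ?_)
    · exact (ae_restrict_iff' hA).mpr (.of_forall fun x hx => (hpos x hx).le)
    · rw [Set.inter_eq_right.mpr fun x hx => Function.mem_support.mpr (hpos x hx).ne']
      exact pos_iff_ne_zero.mpr hne
  rw [eLpNorm_exponent_top]
  refine eLpNormEssSup_le_of_ae_bound ?_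
  have h7 : ∀ᵐ x ∂μ, x ∉ A := measure_eq_zero_iff_ae_notMem.mp h6
  filter_upwards [h7] with x hx
  exact not_lt.mp hx

/-- Let s be the conjugate exponent and I the integral of ‖g‖^s over {‖g‖ ≤ N}. Testing φ on the
truncation of ‖g‖^{s-2} g gives I ≤ ‖φ‖ I^{1/p}, because (s - 1)p = s. Truncation makes I finite, so
I ≤ ‖φ‖^s, and N → ∞ by monotone convergence. -/
theorem eLpNorm_le_of_riesz [p.HolderConjugate q] (hq : q ≠ ⊤) (hp2 : p ≤ 2)
    {φ : Lp H p μ →L[ℂ] ℂ} {g : Lp H 2 μ}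
    (hg : ∀ f : Lp H 2 μ, φ (Lp.inclusionOfLE ℂ hp2 f) = inner ℂ g f) :
    eLpNorm g q μ ≤ ENNReal.ofReal ‖φ‖ := by
  have hp : p ≠ ⊤ := ne_top_of_le_ne_top ENNReal.ofNat_ne_top hp2
  have hgm := Lp.stronglyMeasurable g
  set r := p.toReal with hr
  set s := q.toReal with hs
  have hconj : r.HolderConjugate s :=
    ENNReal.HolderConjugate.toReal_of_ne_top hp hq
  have hs2 : 2 ≤ s := by
    have h1 : r ≤ 2 := by simpa using ENNReal.toReal_mono ENNReal.ofNat_ne_top hp2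
    have h2 := hconj.mul_eq_add
    have h3 := hconj.lt
    nlinarith
  set A : ℕ → Set α := fun N => {x | ‖g x‖ ≤ N} with hAdef
  have hA (N : ℕ) : MeasurableSet (A N) := measurableSet_le hgm.norm.measurable measurable_const
  have hAi (N : ℕ) : Integrable ((A N).indicator fun x => ‖g x‖ ^ s) μ := by
    refine Integrable.of_bound ((hgm.norm.measurable.pow_const s).aestronglyMeasurable.indicator (hA N))
      ((N : ℝ) ^ s) (.of_forall fun x => ?_)
    by_cases hx : x ∈ A N
    · rw [Set.indicator_of_mem hx, Real.norm_of_nonneg (by positivity)]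
      exact Real.rpow_le_rpow (norm_nonneg _) hx (by linarith)
    · rw [Set.indicator_of_notMem hx, norm_zero]; positivity
  have hbound (N : ℕ) : ∫ x, (A N).indicator (fun x => ‖g x‖ ^ s) x ∂μ ≤ ‖φ‖ ^ s := by
    set I := ∫ x, (A N).indicator (fun x => ‖g x‖ ^ s) x ∂μ with hI
    have hI0 : 0 ≤ I := integral_nonneg fun x => Set.indicator_nonneg (fun _ _ => by positivity) x
    have hf := memLp_indicator_norm_rpow_smul (μ := μ) hgm (by linarith : 0 ≤ s - 2) N
    have h1 := Lp.apply_toLp_eq_inner hp2 hg (hf p) (hf 2)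
    have h2 : φ ((hf p).toLp _) = ((I : ℝ) : ℂ) := by
      rw [h1, hI, ← integral_complex_ofReal]
      refine integral_congr_ae (.of_forall fun x => ?_)
      by_cases hx : x ∈ A N
      · have hx' : x ∈ {x | ‖g x‖ ≤ N} := hx
        simp only [Set.indicator_of_mem hx, Set.indicator_of_mem hx', inner_smul_right]
        rw [← norm_rpow_sub_two_mul_inner_self_re hs2, Complex.ofReal_mul]
        congr 1
        exact (inner_self_ofReal_re (𝕜 := ℂ) _).symm
      · have hx' : x ∉ {x | ‖g x‖ ≤ N} := hx
        simp [Set.indicator_of_notMem hx, Set.indicator_of_notMem hx']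
    have h3 : ‖(hf p).toLp _‖ ^ r = I := by
      rw [Lp.norm_rpow_toReal_eq_integral hp]
      refine integral_congr_ae ?_
      filter_upwards [(hf p).coeFn_toLp] with x hx
      rw [hx]
      by_cases hx : x ∈ A N
      · have hx' : x ∈ {x | ‖g x‖ ≤ N} := hx
        simp only [Set.indicator_of_mem hx, Set.indicator_of_mem hx', norm_smul, Complex.norm_real]
        rw [Real.norm_of_nonneg (by positivity)]
        nth_rewrite 2 [← Real.rpow_one ‖g x‖]
        rw [← Real.rpow_add_of_nonneg (norm_nonneg _) (by linarith) (by norm_num),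
          ← Real.rpow_mul (norm_nonneg _)]
        congr 1
        have := hconj.mul_eq_add
        rw [← hr]
        linarith
      · have hx' : x ∉ {x | ‖g x‖ ≤ N} := hx
        simp only [Set.indicator_of_notMem hx, Set.indicator_of_notMem hx', norm_zero]
        exact Real.zero_rpow hconj.ne_zero
    have h4 := φ.le_opNorm ((hf p).toLp _)
    have h5 : ‖(hf p).toLp _‖ = I ^ (r⁻¹) := by
      rw [← h3, Real.rpow_rpow_inv (norm_nonneg _) hconj.ne_zero]
    rw [h2, Complex.norm_real, Real.norm_of_nonneg hI0, h5] at h4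
    rcases hI0.eq_or_lt with h0 | h0
    · rw [← h0]; positivity
    · have h6 : I ^ (s⁻¹) ≤ ‖φ‖ := by
        have : I = I ^ (s⁻¹) * I ^ (r⁻¹) := by
          rw [← Real.rpow_add h0, add_comm, hconj.inv_add_inv_eq_one, Real.rpow_one]
        nth_rewrite 1 [this] at h4
        exact le_of_mul_le_mul_right h4 (by positivity)
      calc I = (I ^ (s⁻¹)) ^ s := (Real.rpow_inv_rpow hI0 hconj.symm.ne_zero).symm
        _ ≤ _ := Real.rpow_le_rpow (by positivity) h6 (by linarith)
  have hlin : ∫⁻ x, ‖g x‖ₑ ^ s ∂μ ≤ ENNReal.ofReal (‖φ‖ ^ s) := by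
    have hU : ⋃ N, A N = Set.univ := by
      refine Set.eq_univ_of_forall fun x => Set.mem_iUnion.mpr ?_
      exact exists_nat_ge ‖g x‖
    rw [← setLIntegral_univ, ← hU, setLIntegral_iUnion_of_directed]
    · refine iSup_le fun N => ?_
      rw [← lintegral_indicator (hA N)]
      refine le_trans (le_of_eq ?_) (ENNReal.ofReal_le_ofReal (hbound N))
      rw [ofReal_integral_eq_lintegral_ofReal (hAi N)
        (.of_forall fun x => Set.indicator_nonneg (fun _ _ => by positivity) x)]
      refine lintegral_congr fun x => ?_
      by_cases hx : x ∈ A N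
      · rw [Set.indicator_of_mem hx, Set.indicator_of_mem hx,
          ← ENNReal.ofReal_rpow_of_nonneg (norm_nonneg _) (by linarith), ofReal_norm]
      · rw [Set.indicator_of_notMem hx, Set.indicator_of_notMem hx, ENNReal.ofReal_zero]
    · refine (monotone_nat_of_le_succ fun N x hx => ?_).directed_le
      have hx' : ‖g x‖ ≤ N := hx
      have : ‖g x‖ ≤ (N + 1 : ℕ) := hx'.trans (by exact_mod_cast N.le_succ)
      exact this
  rw [eLpNorm_eq_lintegral_rpow_enorm_toReal (ENNReal.HolderConjugate.ne_zero q p) hq]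
  rw [← ENNReal.ofReal_rpow_of_nonneg (norm_nonneg φ) (by linarith)] at hlin
  calc _ ≤ (ENNReal.ofReal ‖φ‖ ^ s) ^ (1 / s) := ENNReal.rpow_le_rpow hlin (by positivity)
    _ = _ := by rw [one_div, ENNReal.rpow_rpow_inv hconj.symm.ne_zero]

variable [CompleteSpace H] [Fact (1 ≤ q)] [p.HolderConjugate q]

theorem exists_lp_dual_repr_of_le_two (hp2 : p ≤ 2) (φ : Lp H p μ →L[ℂ] ℂ) :
    ∃ G : Lp (StrongDual ℂ H) q μ, ‖G‖ ≤ ‖φ‖ ∧ ∀ f : Lp H p μ, φ f = ∫ x, G x (f x) ∂μ := by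
  have hp : p ≠ ⊤ := ne_top_of_le_ne_top ENNReal.ofNat_ne_top hp2
  set g : Lp H 2 μ := (InnerProductSpace.toDual ℂ (Lp H 2 μ)).symm
    (φ ∘L Lp.inclusionOfLE ℂ hp2) with hgdef
  have hg (f : Lp H 2 μ) : φ (Lp.inclusionOfLE ℂ hp2 f) = inner ℂ g f := by
    rw [hgdef, InnerProductSpace.toDual_symm_apply]; rfl
  have hge : eLpNorm g q μ ≤ ENNReal.ofReal ‖φ‖ := by
    rcases eq_or_ne q ⊤ with rfl | hq
    · obtain rfl := (ENNReal.HolderConjugate.eq_top_iff_eq_one ⊤ p).mp rfl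
      exact eLpNorm_top_le_of_riesz hp2 hg
    · exact eLpNorm_le_of_riesz hq hp2 hg
  set G₀ : α → StrongDual ℂ H := fun x => InnerProductSpace.toDual ℂ H (g x) with hG₀
  have hG₀e : eLpNorm G₀ q μ = eLpNorm g q μ :=
    eLpNorm_congr_norm_ae (.of_forall fun x => LinearIsometryEquiv.norm_map _ _)
  have hG₀L : MemLp G₀ q μ :=
    ⟨(InnerProductSpace.toDual ℂ H).continuous.comp_aestronglyMeasurable (Lp.aestronglyMeasurable g),
      by rw [hG₀e]; exact hge.trans_lt ENNReal.ofReal_lt_top⟩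
  obtain ⟨ψ, hψ⟩ := exists_clm_eq_integral (p := p) (hG₀L.toLp G₀)
  refine ⟨hG₀L.toLp G₀, ?_, ?_⟩
  · rw [Lp.norm_toLp, hG₀e]
    exact ENNReal.toReal_le_of_le_ofReal (norm_nonneg φ) hge
  suffices h : ∀ f : Lp H p μ, φ f = ψ f from fun f => (h f).trans (hψ f).2
  have hLp {f : α → H} (hf : MemLp f p μ) (hf2 : MemLp f 2 μ) : φ (hf.toLp f) = ψ (hf.toLp f) := by
    rw [Lp.apply_toLp_eq_inner hp2 hg hf hf2, (hψ _).2]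
    refine integral_congr_ae ?_
    filter_upwards [hG₀L.coeFn_toLp, hf.coeFn_toLp] with x h1 h2
    rw [h1, h2, InnerProductSpace.toDual_apply_apply]
  -- Agreement on functions that also lie in L² covers simple functions, which are dense as p < ∞.
  refine fun f => Lp.induction hp (fun f => φ f = ψ f) ?_ ?_ ?_ f
  · intro c A hA hμA
    exact hLp (memLp_indicator_const p hA c (.inr hμA.ne)) (memLp_indicator_const 2 hA c (.inr hμA.ne))
  · intro f g hf hg _ h1 h2
    rw [map_add, map_add, h1, h2]
  · exact isClosed_eq φ.continuous ψ.continuous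

/-- Every bounded functional on `L^p(μ, H)`, `p < ∞`, is given by an element of `L^q(μ, H')` of norm
at most that of the functional. -/
theorem exists_lp_dual_repr (hp : p ≠ ⊤) (φ : Lp H p μ →L[ℂ] ℂ) :
    ∃ G : Lp (StrongDual ℂ H) q μ, ‖G‖ ≤ ‖φ‖ ∧ ∀ f : Lp H p μ, φ f = ∫ x, G x (f x) ∂μ :=
  (le_total p 2).elim (exists_lp_dual_repr_of_le_two · φ) (exists_lp_dual_repr_of_two_le hp · φ)

end Duality


/-! ### Nuclear series and their pointwise convergence -/

theorem summable_mul_of_summable_rpow_mul_rpow {a b : ℕ → ℝ} (ha : ∀ k, 0 ≤ a k) (hb : ∀ k, 0 ≤ b k)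
    {s : ℝ} (hs0 : 0 < s) (hs1 : s ≤ 1) (h : Summable fun k => a k ^ s * b k ^ s) :
    Summable fun k => a k * b k := by
  refine Summable.of_norm_bounded_eventually_nat h ?_
  -- The terms (aₖ bₖ)^s are eventually below 1, and there t ≤ t^s because s ≤ 1.
  filter_upwards [h.tendsto_atTop_zero.eventually_lt_const one_pos] with k hk
  rw [← Real.mul_rpow (ha k) (hb k)] at hk ⊢
  have h0 := mul_nonneg (ha k) (hb k)
  rw [Real.norm_of_nonneg h0]
  have h1 : a k * b k ≤ 1 := by
    by_contra! hlt
    exact hk.not_ge (Real.one_le_rpow hlt.le hs0.le)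
  exact Real.self_le_rpow_of_le_one h0 h1 hs1

theorem exists_clm_hasSum_smul {E F : Type*} [NormedAddCommGroup E] [NormedSpace ℂ E]
    [NormedAddCommGroup F] [NormedSpace ℂ F] [CompleteSpace F] {φ : ℕ → (E →L[ℂ] ℂ)} {h : ℕ → F}
    (hs : Summable fun k => ‖φ k‖ * ‖h k‖) :
    ∃ T : E →L[ℂ] F, ∀ f, HasSum (fun k => φ k f • h k) (T f) := by
  have hop : Summable fun k => (φ k).smulRight (h k) := by
    refine .of_norm ?_
    simpa only [ContinuousLinearMap.norm_smulRight_apply] using hs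
  refine ⟨∑' k, (φ k).smulRight (h k), fun f => ?_⟩
  have h1 := hop.hasSum.mapL (ContinuousLinearMap.apply ℂ F f)
  simpa only [ContinuousLinearMap.apply_apply, ContinuousLinearMap.smulRight_apply] using h1

theorem summable_norm_apply_mul {E : Type*} [NormedAddCommGroup E] [NormedSpace ℂ E]
    {φ : ℕ → (E →L[ℂ] ℂ)} {b : ℕ → ℝ} (hb : ∀ k, 0 ≤ b k) (hs : Summable fun k => ‖φ k‖ * b k)
    (f : E) : Summable fun k => ‖φ k f‖ * b k := by
  refine .of_nonneg_of_le (fun k => mul_nonneg (norm_nonneg _) (hb k)) (fun k => ?_)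
    (hs.mul_left ‖f‖)
  rw [← mul_assoc, mul_comm ‖f‖]
  exact mul_le_mul_of_nonneg_right ((φ k).le_opNorm f) (hb k)

theorem summable_norm_apply_rpow_mul {E F : Type*} [NormedAddCommGroup E] [NormedSpace ℂ E]
    [NormedAddCommGroup F] [NormedSpace ℂ F] (Λ : E →L[ℂ] F) {s : ℝ} (hs0 : 0 < s) {g : ℕ → E}
    {b : ℕ → ℝ} (hb : ∀ k, 0 ≤ b k) (hs : Summable fun k => b k * ‖g k‖ ^ s) :
    Summable fun k => ‖Λ (g k)‖ ^ s * b k := by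
  refine .of_nonneg_of_le (fun k => mul_nonneg (by positivity) (hb k)) (fun k => ?_)
    (hs.mul_left (‖Λ‖ ^ s))
  have h1 := Real.rpow_le_rpow (norm_nonneg _) (Λ.le_opNorm (g k)) hs0.le
  rw [Real.mul_rpow (norm_nonneg _) (norm_nonneg _)] at h1
  exact (mul_le_mul_of_nonneg_right h1 (hb k)).trans_eq (by ring)

namespace MeasureTheory.Lp

variable {α : Type*} [MeasurableSpace α] {μ : Measure α} {H : Type*} [NormedAddCommGroup H]
  {p : ℝ≥0∞} [Fact (1 ≤ p)]

theorem tsum_enorm_ne_top {u : ℕ → Lp H p μ} (h : Summable fun k => ‖u k‖) :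
    ∑' k, ‖u k‖ₑ ≠ ⊤ :=
  tsum_enorm_ne_top_iff_summable_norm.mpr h

theorem ae_hasSum_of_hasSum [CompleteSpace H] {u : ℕ → Lp H p μ} (h : Summable fun k => ‖u k‖)
    {F : Lp H p μ} (hF : HasSum u F) : ∀ᵐ x ∂μ, HasSum (fun k => u k x) (F x) := by
  rw [← hF.tsum_eq]
  exact Lp.hasSum_coeFn_tsum (tsum_enorm_ne_top h)

theorem ae_hasSum_smul [NormedSpace ℂ H] [CompleteSpace H] {c : ℕ → ℂ} {u : ℕ → Lp H p μ}
    (h : Summable fun k => ‖c k‖ * ‖u k‖) {F : Lp H p μ} (hF : HasSum (fun k => c k • u k) F) :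
    ∀ᵐ x ∂μ, HasSum (fun k => c k • u k x) (F x) := by
  have h1 := ae_hasSum_of_hasSum (by simpa only [norm_smul] using h) hF
  filter_upwards [h1, ae_all_iff.mpr fun k => Lp.coeFn_smul (c k) (u k)] with x h1 h2
  exact h1.congr_fun fun k => (h2 k).symm

theorem ae_hasSum_apply_smul [NormedSpace ℂ H] [CompleteSpace H] {φ : ℕ → (Lp H p μ →L[ℂ] ℂ)}
    {u : ℕ → Lp H p μ} (h : Summable fun k => ‖φ k‖ * ‖u k‖) {T : Lp H p μ →L[ℂ] Lp H p μ}
    (hT : ∀ f, HasSum (fun k => φ k f • u k) (T f)) (f : Lp H p μ) :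
    ∀ᵐ x ∂μ, HasSum (fun k => φ k f • u k x) (T f x) :=
  ae_hasSum_smul (summable_norm_apply_mul (fun k => norm_nonneg (u k)) h f) (hT f)

theorem ae_summable_mul_norm [NormedSpace ℂ H] {c : ℕ → ℝ} (hc : ∀ k, 0 ≤ c k)
    {u : ℕ → Lp H p μ} (h : Summable fun k => c k * ‖u k‖) :
    ∀ᵐ x ∂μ, Summable fun k => c k * ‖u k x‖ := by
  have hn (k : ℕ) : ‖((c k : ℝ) : ℂ)‖ = c k := by
    rw [Complex.norm_real, Real.norm_of_nonneg (hc k)]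
  have hs : Summable fun k => ‖((c k : ℝ) : ℂ) • u k‖ := by simpa only [norm_smul, hn] using h
  have h1 := summable_norm_of_tsum_eLpNorm_ne_top (μ := μ) (Fact.out : 1 ≤ p)
    (fun k => Lp.aestronglyMeasurable (((c k : ℝ) : ℂ) • u k))
    (by simpa [Lp.enorm_def] using tsum_enorm_ne_top hs)
  filter_upwards [h1, ae_all_iff.mpr fun k => Lp.coeFn_smul ((c k : ℝ) : ℂ) (u k)] with x h1 h2
  refine h1.congr fun k => ?_
  rw [h2 k, Pi.smul_apply, norm_smul, hn]

end MeasureTheory.Lp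

open UnitAddTorus

/-! ### Operators on L^p of the torus and their symbols -/

section Torus

variable {n : ℕ} {H : Type*} [NormedAddCommGroup H] [NormedSpace ℂ H] {p q : ℝ≥0∞} [Fact (1 ≤ p)]

/-- A bounded operator on `L^p(𝕋ⁿ, H)`, `p < ∞`, is determined by its values on the vector-valued
trigonometric monomials. -/
theorem ContinuousLinearMap.ext_mFourierSMul (hp : p ≠ ⊤) {F : Type*} [NormedAddCommGroup F]
    [NormedSpace ℂ F] {S T : Lp H p (torusMeasure n) →L[ℂ] F}
    (h : ∀ ξ v, S (ContinuousMap.toLp p (torusMeasure n) ℂ (mFourierSMul ξ v)) =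
      T (ContinuousMap.toLp p (torusMeasure n) ℂ (mFourierSMul ξ v))) : S = T := by
  have hdense : (Submodule.span ℂ (Set.range fun ξ : Fin n → ℤ =>
      ContinuousMap.toLp (E := ℂ) p (torusMeasure n) ℂ (mFourier ξ))).topologicalClosure = ⊤ :=
    span_mFourierLp_closure_eq_top hp
  -- For fixed `c`, density of scalar trigonometric polynomials gives equality on all functions of
  -- the form (scalar L^p function) · c. Indicators times constants are of this form.
  have hcomp (c : H) : S ∘L (ContinuousLinearMap.toSpanSingleton ℂ c).compLpL p (torusMeasure n) =
      T ∘L (ContinuousLinearMap.toSpanSingleton ℂ c).compLpL p (torusMeasure n) := by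
    refine ContinuousLinearMap.ext_on (Submodule.dense_iff_topologicalClosure_eq_top.mpr hdense) ?_
    rintro _ ⟨ξ, rfl⟩
    have h1 : (ContinuousLinearMap.toSpanSingleton ℂ c).compLpL p (torusMeasure n)
        (ContinuousMap.toLp (E := ℂ) p (torusMeasure n) ℂ (mFourier ξ)) =
          ContinuousMap.toLp p (torusMeasure n) ℂ (mFourierSMul ξ c) := by
      refine Lp.ext ?_
      filter_upwards [ContinuousLinearMap.coeFn_compLpL (ContinuousLinearMap.toSpanSingleton ℂ c)
        (ContinuousMap.toLp (E := ℂ) p (torusMeasure n) ℂ (mFourier ξ)),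
        ContinuousMap.coeFn_toLp (p := p) (𝕜 := ℂ) (torusMeasure n) (mFourier ξ),
        ContinuousMap.coeFn_toLp (p := p) (𝕜 := ℂ) (torusMeasure n) (mFourierSMul ξ c)]
        with x h1 h2 h3
      rw [h1, h2, h3]
      rfl
    simp only [ContinuousLinearMap.comp_apply, h1, h]
  ext f
  refine Lp.induction hp (fun f => S f = T f) ?_ ?_ (isClosed_eq S.continuous T.continuous) f
  · intro c A hA hμA
    have h1 : (Lp.simpleFunc.indicatorConst p hA hμA.ne c : Lp H p (torusMeasure n)) =
        (ContinuousLinearMap.toSpanSingleton ℂ c).compLpL p (torusMeasure n)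
          (indicatorConstLp p hA hμA.ne (1 : ℂ)) := by
      rw [Lp.simpleFunc.coe_indicatorConst]
      refine Lp.ext ?_
      filter_upwards [ContinuousLinearMap.coeFn_compLpL (ContinuousLinearMap.toSpanSingleton ℂ c)
        (indicatorConstLp p hA hμA.ne (1 : ℂ)),
        indicatorConstLp_coeFn (p := p) (hs := hA) (hμs := hμA.ne) (c := (1 : ℂ)),
        indicatorConstLp_coeFn (p := p) (hs := hA) (hμs := hμA.ne) (c := c)] with x h1 h2 h3
      rw [h1, h2, h3]
      by_cases hx : x ∈ A <;> simp [hx]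
    rw [h1]
    exact DFunLike.congr_fun (hcomp c) _
  · intro f g hf hg _ h1 h2
    rw [map_add, map_add, h1, h2]

theorem norm_apply_mFourierCoeff_le [Fact (1 ≤ q)] {B : H →L[ℂ] StrongDual ℂ H} (hB : ‖B‖ ≤ 1)
    (g : Lp H q (torusMeasure n)) (ξ : Fin n → ℤ) (v : H) :
    ‖B (mFourierCoeff g ξ) v‖ ≤ ‖g‖ * ‖v‖ :=
  (B.le_opNorm₂ _ _).trans <| by
    have := norm_mFourierCoeff_le_norm_Lp g ξ
    gcongr
    calc ‖B‖ * ‖mFourierCoeff g ξ‖ ≤ 1 * ‖g‖ := by gcongr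
      _ = ‖g‖ := one_mul _

variable [CompleteSpace H] {σ : UnitAddTorus (Fin n) → (Fin n → ℤ) → (H →L[ℂ] H)}

theorem ExtendsPeriodicOperator.ae_apply_mFourierSMul
    {T : Lp H p (torusMeasure n) →L[ℂ] Lp H p (torusMeasure n)} (hT : ExtendsPeriodicOperator σ T)
    (ξ : Fin n → ℤ) (v : H) : ∀ᵐ x ∂(torusMeasure n),
      T (ContinuousMap.toLp p (torusMeasure n) ℂ (mFourierSMul ξ v)) x =
        mFourier ξ x • σ x ξ v := by
  filter_upwards [hT _ (isTorusSmooth_mFourierSMul ξ v)] with x hx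
  refine hx.unique ?_
  convert! hasSum_ite_eq ξ (mFourier ξ x • σ x ξ v) using 2 with η
  rw [mFourierCoeff_mFourierSMul]
  split_ifs with h
  · rw [h]
  · simp

theorem ExtendsPeriodicOperator.unique (hp : p ≠ ⊤)
    {S T : Lp H p (torusMeasure n) →L[ℂ] Lp H p (torusMeasure n)}
    (hS : ExtendsPeriodicOperator σ S) (hT : ExtendsPeriodicOperator σ T) : S = T := by
  refine ContinuousLinearMap.ext_mFourierSMul hp fun ξ v => Lp.ext ?_
  filter_upwards [hS.ae_apply_mFourierSMul ξ v, hT.ae_apply_mFourierSMul ξ v] with x h1 h2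
  rw [h1, h2]

variable [Fact (1 ≤ q)] [q.HolderConjugate p]

/-- The pairing involves no conjugation, so the character enters as e^{2πi x·ξ}; this is why the
coefficient is taken at -ξ. -/
theorem lpPairing_mFourierSMul (B : H →L[ℂ] StrongDual ℂ H) (g : Lp H q (torusMeasure n))
    (ξ : Fin n → ℤ) (v : H) :
    B.lpPairing (torusMeasure n) q p g
        (ContinuousMap.toLp p (torusMeasure n) ℂ (mFourierSMul ξ v)) =
      B (mFourierCoeff g (-ξ)) v := by
  have hg : Integrable g (torusMeasure n) :=
    memLp_one_iff_integrable.mp ((Lp.memLp g).mono_exponent Fact.out)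
  have hgi : Integrable (fun x => mFourier (- -ξ) x • g x) (torusMeasure n) := by
    refine hg.mono ((ContinuousMap.continuous _).aestronglyMeasurable.smul
      (Lp.aestronglyMeasurable g)) (.of_forall fun x => ?_)
    rw [norm_smul, norm_mFourier_apply, one_mul]
  rw [ContinuousLinearMap.lpPairing_eq_integral, mFourierCoeff_eq]
  refine Eq.trans ?_ ((B.flip v).integral_comp_comm hgi)
  refine integral_congr_ae ?_
  filter_upwards [ContinuousMap.coeFn_toLp (p := p) (𝕜 := ℂ) (torusMeasure n) (mFourierSMul ξ v)]
    with x hx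
  rw [hx]
  simp

/-- Uniform convergence of the Fourier series of `f` suffices; nothing is required of the Fourier
series of `g`. -/
theorem hasSum_lpPairing_of_isTorusSmooth (B : H →L[ℂ] StrongDual ℂ H)
    (g : Lp H q (torusMeasure n)) {f : C(UnitAddTorus (Fin n), H)} (hf : IsTorusSmooth f) :
    HasSum (fun ξ => B (mFourierCoeff g (-ξ)) (mFourierCoeff f ξ))
      (B.lpPairing (torusMeasure n) q p g (ContinuousMap.toLp p (torusMeasure n) ℂ f)) := by
  have h := (B.lpPairing (torusMeasure n) q p g ∘L
    ContinuousMap.toLp p (torusMeasure n) ℂ).hasSum hf.hasSum_mFourier_series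
  refine h.congr_fun fun ξ => ?_
  exact (lpPairing_mFourierSMul B g ξ _).symm

/-- The pointwise exchange of the sums over the frequencies and over the nuclear expansion. -/
theorem hasSum_mFourier_smul_symbol {B : H →L[ℂ] StrongDual ℂ H} (hB : ‖B‖ ≤ 1)
    {g : ℕ → Lp H q (torusMeasure n)} {u : ℕ → H} (hu : Summable fun k => ‖g k‖ * ‖u k‖)
    {x : UnitAddTorus (Fin n)} (hσ : ∀ (ξ : Fin n → ℤ) (v : H),
      HasSum (fun k => mFourier (-ξ) x • B (mFourierCoeff (g k) (-ξ)) v • u k) (σ x ξ v))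
    {f : C(UnitAddTorus (Fin n), H)} (hf : IsTorusSmooth f) {w : H}
    (hw : HasSum (fun k => B.lpPairing (torusMeasure n) q p (g k)
      (ContinuousMap.toLp p (torusMeasure n) ℂ f) • u k) w) :
    HasSum (fun ξ : Fin n → ℤ => mFourier ξ x • σ x ξ (mFourierCoeff f ξ)) w := by
  -- Since ‖ĝₖ(-ξ)‖ ≤ ‖gₖ‖, the double family is dominated by the product of the summable families
  -- ‖f̂(ξ)‖ and ‖gₖ‖ ‖uₖ‖. Summing over k first gives the symbol series; summing over ξ first gives
  -- `w`.
  have hS : Summable fun z : (Fin n → ℤ) × ℕ =>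
      B (mFourierCoeff (g z.2) (-z.1)) (mFourierCoeff f z.1) • u z.2 := by
    refine .of_norm_bounded (hf.summable_norm_mFourierCoeff.mul_of_nonneg hu
      (fun _ => norm_nonneg _) fun _ => mul_nonneg (norm_nonneg _) (norm_nonneg _)) fun z => ?_
    rw [norm_smul, ← mul_assoc, mul_comm ‖mFourierCoeff f z.1‖]
    exact mul_le_mul_of_nonneg_right (norm_apply_mFourierCoeff_le hB _ _ _) (norm_nonneg _)
  have hrow := hS.hasSum.prod_fiberwise (g := fun ξ => mFourier ξ x • σ x ξ (mFourierCoeff f ξ))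
    fun ξ => by
      refine ((hσ ξ (mFourierCoeff f ξ)).const_smul (mFourier ξ x)).congr_fun fun k => ?_
      rw [smul_smul, mFourier_mul_neg, one_smul]
  have hcol := ((Equiv.prodComm ℕ (Fin n → ℤ)).hasSum_iff.mpr hS.hasSum).prod_fiberwise
    (g := fun k => B.lpPairing (torusMeasure n) q p (g k)
      (ContinuousMap.toLp p (torusMeasure n) ℂ f) • u k)
    fun k => (hasSum_lpPairing_of_isTorusSmooth B (g k) hf).smul_const (u k)
  rwa [hcol.unique hw] at hrow

/-- A nuclear expansion of the symbol yields an `s`-nuclear extension of the periodic operator. -/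
theorem exists_extends_isSNuclear {B : H →L[ℂ] StrongDual ℂ H} (hB : ‖B‖ ≤ 1) {s : ℝ} (hs0 : 0 < s)
    (hs1 : s ≤ 1) {h : ℕ → Lp H p (torusMeasure n)} {g : ℕ → Lp H q (torusMeasure n)}
    (hsum : Summable fun k => ‖h k‖ ^ s * ‖g k‖ ^ s)
    (hσ : ∀ᵐ x ∂(torusMeasure n), ∀ (ξ : Fin n → ℤ) (v : H),
      HasSum (fun k => mFourier (-ξ) x • B (mFourierCoeff (g k) (-ξ)) v • h k x) (σ x ξ v)) :
    ∃ T : Lp H p (torusMeasure n) →L[ℂ] Lp H p (torusMeasure n),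
      ExtendsPeriodicOperator σ T ∧ IsSNuclear s T := by
  have hsum1 := summable_norm_apply_rpow_mul (B.lpPairing (torusMeasure n) q p) hs0
    (fun k => Real.rpow_nonneg (norm_nonneg (h k)) s) hsum
  have hsum2 := summable_mul_of_summable_rpow_mul_rpow (fun k => norm_nonneg _)
    (fun k => norm_nonneg (h k)) hs0 hs1 hsum1
  have hsum3 : Summable fun k => ‖g k‖ * ‖h k‖ :=
    (summable_mul_of_summable_rpow_mul_rpow (fun k => norm_nonneg (h k))
      (fun k => norm_nonneg (g k)) hs0 hs1 hsum).congr fun k => mul_comm _ _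
  obtain ⟨T, hT⟩ := exists_clm_hasSum_smul hsum2
  refine ⟨T, fun f hf => ?_, _, h, hsum1, hT⟩
  filter_upwards [hσ, Lp.ae_hasSum_apply_smul hsum2 hT (ContinuousMap.toLp p (torusMeasure n) ℂ f),
    Lp.ae_summable_mul_norm (fun k => norm_nonneg (g k)) hsum3] with x h1 h2 h3
  exact hasSum_mFourier_smul_symbol hB h3 h1 hf h2

/-- A nuclear expansion of the symbol at a point need only be checked on a dense sequence. -/
theorem hasSum_symbol_of_denseRange {B : H →L[ℂ] StrongDual ℂ H} (hB : ‖B‖ ≤ 1)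
    {g : ℕ → Lp H q (torusMeasure n)} {u : ℕ → H} (hu : Summable fun k => ‖g k‖ * ‖u k‖)
    (x : UnitAddTorus (Fin n)) (ξ : Fin n → ℤ) {A : H →L[ℂ] H} {d : ℕ → H} (hd : DenseRange d)
    (hA : ∀ i, HasSum (fun k => mFourier (-ξ) x • B (mFourierCoeff (g k) (-ξ)) (d i) • u k)
      (A (d i))) (v : H) :
    HasSum (fun k => mFourier (-ξ) x • B (mFourierCoeff (g k) (-ξ)) v • u k) (A v) := by
  obtain ⟨R, hR⟩ := exists_clm_hasSum_smul
    (φ := fun k => mFourier (-ξ) x • B (mFourierCoeff (g k) (-ξ))) (h := u) <| by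
      refine .of_nonneg_of_le (fun k => mul_nonneg (norm_nonneg _) (norm_nonneg _)) (fun k => ?_) hu
      refine mul_le_mul_of_nonneg_right ?_ (norm_nonneg _)
      rw [norm_smul, norm_mFourier_apply, one_mul]
      exact ContinuousLinearMap.opNorm_le_bound _ (norm_nonneg _)
        (norm_apply_mFourierCoeff_le hB (g k) (-ξ))
  simp only [smul_apply, smul_assoc] at hR
  have heq : ⇑R = A := hd.equalizer R.continuous A.continuous
    (funext fun i => (hR _).unique (hA i))
  rw [← heq]
  exact hR v

/-- The symbol of an `s`-nuclear extension of the periodic operator has a nuclear expansion. -/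
theorem exists_hasSum_symbol [TopologicalSpace.SeparableSpace H]
    {B : H →L[ℂ] StrongDual ℂ H} (hB : ‖B‖ ≤ 1)
    (hrepr : ∀ φ : Lp H p (torusMeasure n) →L[ℂ] ℂ, ∃ g : Lp H q (torusMeasure n), ‖g‖ ≤ ‖φ‖ ∧
      φ = B.lpPairing (torusMeasure n) q p g) {s : ℝ} (hs0 : 0 < s) (hs1 : s ≤ 1)
    {T : Lp H p (torusMeasure n) →L[ℂ] Lp H p (torusMeasure n)}
    (hT : ExtendsPeriodicOperator σ T) (hTn : IsSNuclear s T) :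
    ∃ (h : ℕ → Lp H p (torusMeasure n)) (g : ℕ → Lp H q (torusMeasure n)),
      (Summable fun k => ‖h k‖ ^ s * ‖g k‖ ^ s) ∧
        ∀ᵐ x ∂(torusMeasure n), ∀ (ξ : Fin n → ℤ) (v : H),
          HasSum (fun k => mFourier (-ξ) x • B (mFourierCoeff (g k) (-ξ)) v • h k x)
            (σ x ξ v) := by
  obtain ⟨φ, h, hsum, hφ⟩ := hTn
  choose g hg hgφ using fun k => hrepr (φ k)
  have hsum1 : Summable fun k => ‖h k‖ ^ s * ‖g k‖ ^ s := by
    refine .of_nonneg_of_le (fun k => mul_nonneg (Real.rpow_nonneg (norm_nonneg (h k)) s)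
      (Real.rpow_nonneg (norm_nonneg (g k)) s)) (fun k => ?_) hsum
    rw [mul_comm]
    exact mul_le_mul_of_nonneg_right (Real.rpow_le_rpow (norm_nonneg (g k)) (hg k) hs0.le)
      (Real.rpow_nonneg (norm_nonneg (h k)) s)
  have hsum2 := summable_mul_of_summable_rpow_mul_rpow (fun k => norm_nonneg (φ k))
    (fun k => norm_nonneg (h k)) hs0 hs1 hsum
  have hsum3 : Summable fun k => ‖g k‖ * ‖h k‖ :=
    (summable_mul_of_summable_rpow_mul_rpow (fun k => norm_nonneg (h k))
      (fun k => norm_nonneg (g k)) hs0 hs1 hsum1).congr fun k => mul_comm _ _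
  refine ⟨h, g, hsum1, ?_⟩
  -- The null set here depends on `v` and `ξ`. Only countably many pairs are used below, and
  -- separability of `H` lets a dense sequence stand for all `v`.
  have hae (v : H) (ξ : Fin n → ℤ) : ∀ᵐ x ∂(torusMeasure n),
      HasSum (fun k => mFourier (-ξ) x • B (mFourierCoeff (g k) (-ξ)) v • h k x) (σ x ξ v) := by
    filter_upwards [Lp.ae_hasSum_apply_smul hsum2 hφ
      (ContinuousMap.toLp p (torusMeasure n) ℂ (mFourierSMul ξ v)),
      hT.ae_apply_mFourierSMul ξ v] with x h1 h2
    rw [h2] at h1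
    have h3 := h1.const_smul (mFourier (-ξ) x)
    rw [smul_smul, mFourier_neg_mul, one_smul] at h3
    refine h3.congr_fun fun k => ?_
    rw [hgφ k, lpPairing_mFourierSMul]
  filter_upwards [ae_all_iff.mpr fun i => ae_all_iff.mpr (hae (TopologicalSpace.denseSeq H i)),
    Lp.ae_summable_mul_norm (fun k => norm_nonneg (g k)) hsum3] with x h1 h2 ξ v
  exact hasSum_symbol_of_denseRange hB h2 x ξ (TopologicalSpace.denseRange_denseSeq H)
    (fun i => h1 i ξ) v

end Torus

/-! ### The bilinear pairing on L²(Y, ν) -/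

section Pairing

variable {Y : Type*} [MeasurableSpace Y] (ν : Measure Y)

/-- The bilinear pairing `(w, v) ↦ ∫ w v dν` on `L²(Y, ν)`. -/
def bilinPairing : Lp ℂ 2 ν →L[ℂ] StrongDual ℂ (Lp ℂ 2 ν) :=
  (ContinuousLinearMap.mul ℂ ℂ).lpPairing ν 2 2

variable {ν}

theorem bilinPairing_apply (w v : Lp ℂ 2 ν) : bilinPairing ν w v = ∫ z, w z * v z ∂ν :=
  ContinuousLinearMap.lpPairing_eq_integral _ _ _

theorem tensorAct_eq_bilinPairing (h w v : Lp ℂ 2 ν) :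
    tensorAct h w v = bilinPairing ν w v • h := by
  rw [bilinPairing_apply, tensorAct]

/-- The Riesz map and complex conjugation are both conjugate-linear isometric bijections, so their
composite is a linear isometric identification of L² with its dual. -/
theorem bilinPairing_eq_toDual_star (w : Lp ℂ 2 ν) :
    bilinPairing ν w = InnerProductSpace.toDual ℂ (Lp ℂ 2 ν) (star w) := by
  ext v
  rw [bilinPairing_apply, InnerProductSpace.toDual_apply_apply, L2.inner_def]
  refine integral_congr_ae ?_
  filter_upwards [Lp.coeFn_star w] with z hz
  rw [hz, RCLike.inner_apply]
  simp [mul_comm]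

theorem MeasureTheory.Lp.norm_star_eq (w : Lp ℂ 2 ν) : ‖star w‖ = ‖w‖ := by
  rw [Lp.norm_def, Lp.norm_def]
  congr 1
  refine eLpNorm_congr_norm_ae ?_
  filter_upwards [Lp.coeFn_star w] with z hz
  rw [hz, Pi.star_apply, norm_star]

theorem norm_bilinPairing_apply (w : Lp ℂ 2 ν) : ‖bilinPairing ν w‖ = ‖w‖ := by
  rw [bilinPairing_eq_toDual_star, LinearIsometryEquiv.norm_map, Lp.norm_star_eq]

theorem norm_bilinPairing_le : ‖bilinPairing ν‖ ≤ 1 :=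
  ContinuousLinearMap.opNorm_le_bound _ zero_le_one fun w => by
    rw [norm_bilinPairing_apply, one_mul]

variable (ν) in
/-- The pairing `(w, v) ↦ ∫ w v dν` identifies `L²(Y, ν)` with its dual. -/
def bilinPairingEquiv : Lp ℂ 2 ν ≃ₗᵢ[ℂ] StrongDual ℂ (Lp ℂ 2 ν) :=
  LinearIsometryEquiv.ofSurjective ⟨(bilinPairing ν).toLinearMap, norm_bilinPairing_apply⟩ fun ℓ => by
    refine ⟨star ((InnerProductSpace.toDual ℂ (Lp ℂ 2 ν)).symm ℓ), ?_⟩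
    refine (bilinPairing_eq_toDual_star _).trans ?_
    rw [star_star, LinearIsometryEquiv.apply_symm_apply]

theorem exists_eq_lpPairing_bilinPairing {α : Type*} [MeasurableSpace α] {μ : Measure α}
    [IsProbabilityMeasure μ] {p q : ℝ≥0∞} [Fact (1 ≤ p)] [Fact (1 ≤ q)] [p.HolderConjugate q]
    (hp : p ≠ ⊤) (φ : Lp (Lp ℂ 2 ν) p μ →L[ℂ] ℂ) :
    ∃ g : Lp (Lp ℂ 2 ν) q μ, ‖g‖ ≤ ‖φ‖ ∧ φ = (bilinPairing ν).lpPairing μ q p g := by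
  obtain ⟨G, hG, hφ⟩ := exists_lp_dual_repr (q := q) hp φ
  -- Applying the inverse of the pairing pointwise turns the H'-valued representative into an
  -- H-valued one without increasing its norm.
  set K : StrongDual ℂ (Lp ℂ 2 ν) →L[ℂ] Lp ℂ 2 ν :=
    (bilinPairingEquiv ν).symm.toContinuousLinearEquiv.toContinuousLinearMap with hK
  have hBK (ℓ : StrongDual ℂ (Lp ℂ 2 ν)) : bilinPairing ν (K ℓ) = ℓ :=
    (bilinPairingEquiv ν).apply_symm_apply ℓ
  have hKn : ‖K‖ ≤ 1 := ContinuousLinearMap.opNorm_le_bound _ zero_le_one fun ℓ => by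
    rw [one_mul]
    exact ((bilinPairingEquiv ν).symm.norm_map ℓ).le
  refine ⟨K.compLp G, ?_, ?_⟩
  · calc _ ≤ ‖K‖ * ‖G‖ := K.norm_compLp_le G
      _ ≤ 1 * ‖φ‖ := by gcongr
      _ = ‖φ‖ := one_mul _
  · ext f
    rw [hφ, ContinuousLinearMap.lpPairing_eq_integral]
    refine integral_congr_ae ?_
    filter_upwards [K.coeFn_compLp G] with x hx
    rw [hx, hBK]

end Pairing

end

/-! ### The characterisation of s-nuclearity -/

theorem theorem3p1 {n : ℕ} {Y : Type*} [MeasurableSpace Y] (ν : Measure Y) [SigmaFinite ν]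
    [TopologicalSpace.SeparableSpace (Lp ℂ 2 ν)]
    (s : ℝ) (hs0 : 0 < s) (hs1 : s ≤ 1)
    (p q : ℝ≥0∞) [Fact (1 ≤ p)] (hp : p ≠ ⊤) (hpq : p.HolderConjugate q)
    (σ : UnitAddTorus (Fin n) → (Fin n → ℤ) → (Lp ℂ 2 ν →L[ℂ] Lp ℂ 2 ν)) :
    ((∃ T : Lp (Lp ℂ 2 ν) p (torusMeasure n) →L[ℂ] Lp (Lp ℂ 2 ν) p (torusMeasure n),
        ExtendsPeriodicOperator σ T ∧ IsSNuclear s T) ↔ HasNuclearSymbol s p q σ) ∧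
      ∀ T : Lp (Lp ℂ 2 ν) p (torusMeasure n) →L[ℂ] Lp (Lp ℂ 2 ν) p (torusMeasure n),
        ExtendsPeriodicOperator σ T → (IsSNuclear s T ↔ HasNuclearSymbol s p q σ) := by
  have : Fact (1 ≤ q) := ⟨ENNReal.HolderConjugate.one_le q p⟩
  have hforward (T : Lp (Lp ℂ 2 ν) p (torusMeasure n) →L[ℂ] Lp (Lp ℂ 2 ν) p (torusMeasure n))
      (hT : ExtendsPeriodicOperator σ T) (hTn : IsSNuclear s T) : HasNuclearSymbol s p q σ := by
    obtain ⟨h, g, hsum, hσ⟩ := exists_hasSum_symbol (q := q) norm_bilinPairing_le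
      (exists_eq_lpPairing_bilinPairing hp) hs0 hs1 hT hTn
    refine ⟨h, g, hsum, ?_⟩
    simpa only [tensorAct_eq_bilinPairing] using hσ
  have hbackward (h : HasNuclearSymbol s p q σ) :
      ∃ T : Lp (Lp ℂ 2 ν) p (torusMeasure n) →L[ℂ] Lp (Lp ℂ 2 ν) p (torusMeasure n),
        ExtendsPeriodicOperator σ T ∧ IsSNuclear s T := by
    obtain ⟨h, g, hsum, hσ⟩ := h
    simp only [tensorAct_eq_bilinPairing] at hσ
    exact exists_extends_isSNuclear norm_bilinPairing_le hs0 hs1 hsum hσ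
  refine ⟨⟨fun ⟨T, hT, hTn⟩ => hforward T hT hTn, hbackward⟩, fun T hT => ⟨hforward T hT, fun h => ?_⟩⟩
  -- The symbol yields some s-nuclear extension, and uniqueness identifies it with `T`.
  obtain ⟨S, hS, hSn⟩ := hbackward h
  rwa [hT.unique hp hS]
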